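/- **Theorem 1.3 (Equivariant De Rham's Approximation Theorem).** Let $\mathcal M$ be a smooth $n$-manifold (Hausdorff, second countable, without boundary), let $\mathcal G$ be a compact Lie group acting smoothly on $\mathcal M$, and write $\alpha^g(x)=g\cdot x$. Let $\mathscr D^m(\mathcal M)$ be the space of compactly supported $C^\infty$ $m$-forms on $\mathcal M$ and $\mathscr D_m(\mathcal M)$ the space of $m$-currents, i.e. of continuous linear functionals on $\mathscr D^m(\mathcal M)$. A current $T$ is $\mathcal G$-invariant if $(\alpha^g)_*T=T$, i.e. $T((\alpha^g)^*\omega)=T(\omega)$ for all $\omega$, for every $g\in\mathcal G$. It is of class $C^\infty$ if in every smooth chart it has $C^\infty$ coefficients, i.e. $T(\omega)=\int\sum_I f_I\,\omega_I\,dy$ with $C^\infty$ functions $f_I$ for all $\omega=\sum_I\omega_I\,dy_I\in\mathscr D^m(\mathcal M)$ supported in the chart. Then there are linear operators $\mathcal Z_{\mathcal G}=\mathcal Z_{\mathcal G,\varepsilon}\colon\mathscr D_m(\mathcal M)\to\mathscr D_m(\mathcal M)$, depending on a number $\varepsilon>0$, such that for every $\mathcal G$-invariant $m$-current $T$ on $\mathcal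 M$: (a) $\mathcal Z_{\mathcal G}T$ is an $m$-current of class $C^\infty$ for every $\varepsilon>0$; (b) $\mathcal Z_{\mathcal G}T$ is $\mathcal G$-invariant for every $\varepsilon>0$; (c) $\mathcal Z_{\mathcal G}T$ converges weakly to $T$ as $\varepsilon\to0$, i.e. $\mathcal Z_{\mathcal G,\varepsilon}T(\omega)\to T(\omega)$ for every $\omega\in\mathscr D^m(\mathcal M)$. -/

import Mathlib

open Set Filter Topology MeasureTheory
open scoped Manifold ContDiff

noncomputable section

namespace DeRham

/-- An arbitrary (not necessarily smooth) field of alternating `m`-linear forms on the tangent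
spaces of the `n`-dimensional manifold `M`. -/
abbrev FormField (n : ℕ) (M : Type*) [TopologicalSpace M]
    [ChartedSpace (EuclideanSpace ℝ (Fin n)) M] (m : ℕ) : Type _ :=
  ∀ x : M, TangentSpace (𝓡 n) x [⋀^Fin m]→L[ℝ] ℝ

section Forms

variable {n m : ℕ} {M : Type*} [TopologicalSpace M]
  [ChartedSpace (EuclideanSpace ℝ (Fin n)) M]

/-- The expression `(e⁻¹)^* α` of `α` in the chart `e`, a form on `ℝⁿ` (meaningful on
`e.target`). Its values on tuples of standard basis vectors are the coefficients of `α`. -/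
def chartRep (e : OpenPartialHomeomorph M (EuclideanSpace ℝ (Fin n))) (α : FormField n M m)
    (y : EuclideanSpace ℝ (Fin n)) : EuclideanSpace ℝ (Fin n) [⋀^Fin m]→L[ℝ] ℝ :=
  (α (e.symm y)).compContinuousLinearMap
    (mfderiv (𝓡 n) (𝓡 n) e.symm y :
      EuclideanSpace ℝ (Fin n) →L[ℝ] TangentSpace (𝓡 n) (e.symm y))

/-- The support of `α`. -/
def formSupport (α : FormField n M m) : Set M := closure {x | α x ≠ 0}

/-- `α` is of class `C^∞`: its coefficients in every smooth chart are. -/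
def IsSmoothForm (α : FormField n M m) : Prop :=
  ∀ e ∈ IsManifold.maximalAtlas (𝓡 n) ∞ M, ContDiffOn ℝ ∞ (chartRep e α) e.target

/-- The pullback `f^* α`, that is `(f^* α)_x (v₁, …, v_m) = α_{f x} (df_x v₁, …, df_x v_m)`. -/
def pullbackField (f : M → M) (α : FormField n M m) : FormField n M m :=
  fun x => (α (f x)).compContinuousLinearMap (mfderiv (𝓡 n) (𝓡 n) f x)

theorem chartRep_add (e : OpenPartialHomeomorph M (EuclideanSpace ℝ (Fin n)))
    (α η : FormField n M m) : chartRep e (α + η) = chartRep e α + chartRep e η := rfl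

theorem chartRep_smul (e : OpenPartialHomeomorph M (EuclideanSpace ℝ (Fin n)))
    (c : ℝ) (α : FormField n M m) : chartRep e (c • α) = c • chartRep e α := rfl

theorem chartRep_zero (e : OpenPartialHomeomorph M (EuclideanSpace ℝ (Fin n))) :
    chartRep e (0 : FormField n M m) = 0 := rfl

theorem formSupport_zero : formSupport (0 : FormField n M m) = ∅ := by
  simp [formSupport]

theorem formSupport_add (α η : FormField n M m) :
    formSupport (α + η) ⊆ formSupport α ∪ formSupport η := by
  rw [formSupport, formSupport, formSupport, ← closure_union]
  refine closure_mono fun x hx => ?_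
  by_contra h
  simp only [mem_union, mem_ofPred_eq, not_or, not_not] at h
  exact hx (by simp [h.1, h.2])

theorem formSupport_smul (c : ℝ) (α : FormField n M m) :
    formSupport (c • α) ⊆ formSupport α := by
  refine closure_mono fun x hx => ?_
  intro h
  exact hx (by simp [h])

end Forms

/-- The space `𝒟^m(M)` of `C^∞` differential `m`-forms with compact support on `M`. -/
def testForms (n : ℕ) (M : Type*) [TopologicalSpace M]
    [ChartedSpace (EuclideanSpace ℝ (Fin n)) M] (m : ℕ) : Submodule ℝ (FormField n M m) where
  carrier := {α | IsSmoothForm α ∧ IsCompact (formSupport α)}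
  zero_mem' := by
    refine ⟨fun e _ => ?_, ?_⟩
    · rw [chartRep_zero]
      exact contDiffOn_const
    · rw [formSupport_zero]
      exact isCompact_empty
  add_mem' := by
    rintro α η ⟨h1, h2⟩ ⟨h3, h4⟩
    refine ⟨fun e he => ?_, ?_⟩
    · rw [chartRep_add]
      exact (h1 e he).add (h3 e he)
    · exact (h2.union h4).of_isClosed_subset isClosed_closure (formSupport_add α η)
  smul_mem' := by
    rintro c α ⟨h1, h2⟩
    refine ⟨fun e he => ?_, ?_⟩
    · rw [chartRep_smul]
      exact contDiffOn_const.smul (h1 e he)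
    · exact h2.of_isClosed_subset isClosed_closure (formSupport_smul c α)

/-- The pullback `A^* α` of an alternating form by a linear map depends smoothly on `(α, A)`. -/
theorem contDiff_compContinuousLinearMap (n m : ℕ) :
    ContDiff ℝ ∞ (fun p : (EuclideanSpace ℝ (Fin n) [⋀^Fin m]→L[ℝ] ℝ) ×
      (EuclideanSpace ℝ (Fin n) →L[ℝ] EuclideanSpace ℝ (Fin n)) =>
        p.1.compContinuousLinearMap p.2) := by
  let E := EuclideanSpace ℝ (Fin n)
  have : FiniteDimensional ℝ (ContinuousMultilinearMap ℝ (fun _ : Fin m => E) ℝ) :=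
    Module.Finite.of_injective
      (ContinuousMultilinearMap.toMultilinearMapLinear :
        ContinuousMultilinearMap ℝ (fun _ : Fin m => E) ℝ →ₗ[ℝ]
          MultilinearMap ℝ (fun _ : Fin m => E) ℝ)
      ContinuousMultilinearMap.toMultilinearMap_injective
  let J : (E [⋀^Fin m]→L[ℝ] ℝ) →L[ℝ] ContinuousMultilinearMap ℝ (fun _ : Fin m => E) ℝ :=
    ContinuousAlternatingMap.toContinuousMultilinearMapCLM ℝ
  have hJ : LinearMap.ker (J : (E [⋀^Fin m]→L[ℝ] ℝ) →ₗ[ℝ]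
      ContinuousMultilinearMap ℝ (fun _ : Fin m => E) ℝ) = ⊥ :=
    LinearMap.ker_eq_bot.2 fun _ _ h =>
      ContinuousAlternatingMap.toContinuousMultilinearMap_injective h
  obtain ⟨P, hP⟩ := LinearMap.exists_leftInverse_of_injective _ hJ
  have hc : ContDiff ℝ ∞ (fun p : (Fin m → E →L[ℝ] E) ×
      ContinuousMultilinearMap ℝ (fun _ : Fin m => E) ℝ => p.2.compContinuousLinearMap p.1) :=
    contDiff_iff_contDiffAt.2 fun q =>
      (ContinuousMultilinearMap.cpolynomialAt_uncurry_compContinuousLinearMap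
        (𝕜 := ℝ) (Fm := fun _ : Fin m => E) (Em := fun _ : Fin m => E) (G := ℝ)
        (q := q)).analyticAt.contDiffAt
  have hd : ContDiff ℝ ∞ (fun p : (E [⋀^Fin m]→L[ℝ] ℝ) × (E →L[ℝ] E) =>
      LinearMap.toContinuousLinearMap P
        ((J p.1).compContinuousLinearMap (fun _ : Fin m => p.2))) := by
    refine (LinearMap.toContinuousLinearMap P).contDiff.comp
      (hc.comp (f := fun p : (E [⋀^Fin m]→L[ℝ] ℝ) × (E →L[ℝ] E) =>
        ((fun _ : Fin m => p.2), J p.1)) ?_)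
    exact (contDiff_pi.2 fun _ => contDiff_snd).prodMk (J.contDiff.comp contDiff_fst)
  convert hd using 1
  funext p
  exact (LinearMap.congr_fun hP (p.1.compContinuousLinearMap p.2)).symm

section Pullback

variable {n m : ℕ} {M : Type*} [TopologicalSpace M]
  [ChartedSpace (EuclideanSpace ℝ (Fin n)) M]

theorem isSmoothForm_pullbackField [IsManifold (𝓡 n) ∞ M] {f : M → M} (hf : ContMDiff (𝓡 n) (𝓡 n) ∞ f)
    {α : FormField n M m} (hα : IsSmoothForm α) : IsSmoothForm (pullbackField f α) := by
  intro e he y₀ hy₀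
  refine ContDiffAt.contDiffWithinAt ?_
  let E := EuclideanSpace ℝ (Fin n)
  let e' : OpenPartialHomeomorph M E := chartAt E (f (e.symm y₀))
  have he' : e' ∈ IsManifold.maximalAtlas (𝓡 n) ∞ M := IsManifold.chart_mem_maximalAtlas _
  let g : E → E := fun y => e' (f (e.symm y))
  have hes : ∀ y ∈ e.target, ContMDiffAt (𝓡 n) (𝓡 n) ∞ e.symm y := fun y hy =>
    (contMDiffOn_symm_of_mem_maximalAtlas he).contMDiffAt (e.open_target.mem_nhds hy)
  have hfe : ∀ y ∈ e.target, ContMDiffAt (𝓡 n) (𝓡 n) ∞ (fun y => f (e.symm y)) y := fun y hy =>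
    hf.contMDiffAt.comp y (hes y hy)
  have hU : e.target ∩ (fun y => f (e.symm y)) ⁻¹' e'.source ∈ 𝓝 y₀ :=
    inter_mem (e.open_target.mem_nhds hy₀)
      ((hfe y₀ hy₀).continuousAt.preimage_mem_nhds
        (e'.open_source.mem_nhds (mem_chart_source E (f (e.symm y₀)))))
  obtain ⟨U, hUs, hUo, hyU⟩ := mem_nhds_iff.1 hU
  have hg : ∀ y ∈ U, ContDiffAt ℝ ∞ g y := fun y hy =>
    ((((contMDiffOn_of_mem_maximalAtlas he').contMDiffAt
      (e'.open_source.mem_nhds (hUs hy).2)).comp y (hfe y (hUs hy).1))).contDiffAt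
  have hgt : ∀ y ∈ U, g y ∈ e'.target := fun y hy => e'.map_source (hUs hy).2
  have key : ∀ y ∈ U, chartRep e (pullbackField f α) y =
      (chartRep e' α (g y)).compContinuousLinearMap (fderiv ℝ g y) := by
    intro y hy
    have hyt := (hUs hy).1
    have hpt : e'.symm (g y) = f (e.symm y) := e'.left_inv (hUs hy).2
    have hne : (∞ : ℕ∞ω) ≠ 0 := by simp
    have h1 : mfderiv (𝓡 n) (𝓡 n) (fun y => f (e.symm y)) y =
        (mfderiv (𝓡 n) (𝓡 n) f (e.symm y)).comp (mfderiv (𝓡 n) (𝓡 n) e.symm y) :=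
      mfderiv_comp y (hf.contMDiffAt.mdifferentiableAt hne) ((hes y hyt).mdifferentiableAt hne)
    have h2 : mfderiv (𝓡 n) (𝓡 n) (fun y => e'.symm (g y)) y =
        (mfderiv (𝓡 n) (𝓡 n) e'.symm (g y)).comp (mfderiv (𝓡 n) (𝓡 n) g y) :=
      mfderiv_comp y (((contMDiffOn_symm_of_mem_maximalAtlas he').contMDiffAt
        (e'.open_target.mem_nhds (hgt y hy))).mdifferentiableAt hne)
        ((hg y hy).contMDiffAt.mdifferentiableAt hne)
    have h3 : (fun y => e'.symm (g y)) =ᶠ[𝓝 y] fun y => f (e.symm y) := by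
      filter_upwards [hUo.mem_nhds hy] with z hz
      exact e'.left_inv (hUs hz).2
    have hcongr : ∀ (p q : M) (v w : Fin m → E), p = q → v = w →
        (α p : (Fin m → E) → ℝ) v = (α q : (Fin m → E) → ℝ) w := by
      rintro p q v w rfl rfl
      rfl
    ext v
    refine hcongr _ _ _ _ hpt.symm (funext fun i => ?_)
    have h4 := h3.mfderiv_eq (I := 𝓡 n) (I' := 𝓡 n)
    have h5 := (h1.symm.trans h4.symm).trans h2
    rw [mfderiv_eq_fderiv] at h5
    exact DFunLike.congr_fun h5 (v i)
  have hcomp : ContDiffAt ℝ ∞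
      (fun y => (chartRep e' α (g y)).compContinuousLinearMap (fderiv ℝ g y)) y₀ := by
    have a : ContDiffAt ℝ ∞ (fun y => chartRep e' α (g y)) y₀ :=
      ((hα e' he').contDiffAt (e'.open_target.mem_nhds (hgt y₀ hyU))).comp y₀ (hg y₀ hyU)
    have b : ContDiffAt ℝ ∞ (fderiv ℝ g) y₀ := (hg y₀ hyU).fderiv_right (by simp)
    exact (contDiff_compContinuousLinearMap n m).contDiffAt.comp y₀ (a.prodMk b)
  exact hcomp.congr_of_eventuallyEq (by
    filter_upwards [hUo.mem_nhds hyU] with y hy using key y hy)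

theorem pullbackField_add (f : M → M) (α β : FormField n M m) :
    pullbackField f (α + β) = pullbackField f α + pullbackField f β := rfl

theorem pullbackField_smul (f : M → M) (c : ℝ) (α : FormField n M m) :
    pullbackField f (c • α) = c • pullbackField f α := rfl

theorem formSupport_pullbackField (f : M ≃ₘ^∞⟮𝓡 n, 𝓡 n⟯ M) (α : FormField n M m) :
    formSupport (pullbackField f α) ⊆ f ⁻¹' formSupport α := by
  refine closure_minimal (fun x hx => subset_closure fun h => hx ?_)
    (isClosed_closure.preimage f.continuous)
  ext v
  simp [pullbackField, h]

/-- The pullback `f^* : 𝒟^m(M) → 𝒟^m(M)` of compactly supported smooth forms by a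
diffeomorphism `f` of `M`. -/
def pullback [IsManifold (𝓡 n) ∞ M] (f : M ≃ₘ^∞⟮𝓡 n, 𝓡 n⟯ M) :
    testForms n M m →ₗ[ℝ] testForms n M m where
  toFun α := ⟨pullbackField f α.1, isSmoothForm_pullbackField f.contMDiff α.2.1,
    (f.toHomeomorph.isCompact_preimage.2 α.2.2).of_isClosed_subset isClosed_closure
      (formSupport_pullbackField f α.1)⟩
  map_add' α β := Subtype.ext (pullbackField_add f α.1 β.1)
  map_smul' c α := Subtype.ext (pullbackField_smul f c α.1)

end Pullback

section Currents

variable {n m : ℕ} {M : Type*} [TopologicalSpace M]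
  [ChartedSpace (EuclideanSpace ℝ (Fin n)) M]

/-- Convergence `α_j → 0` in `𝒟^m(M)`: the supports of all `α_j` lie in one compact set, and in
every smooth chart all partial derivatives of all coefficients of `α_j` tend to `0`, uniformly on
compact subsets of the chart. -/
def TendstoZero (α : ℕ → testForms n M m) : Prop :=
  (∃ K : Set M, IsCompact K ∧ ∀ j, formSupport (α j : FormField n M m) ⊆ K) ∧
    ∀ e ∈ IsManifold.maximalAtlas (𝓡 n) ∞ M, ∀ L ⊆ e.target, IsCompact L → ∀ r : ℕ,
      TendstoUniformlyOn (fun j => iteratedFDeriv ℝ r (chartRep e (α j : FormField n M m)))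
        0 atTop L

variable (n m M) in
/-- The space `𝒟_m(M)` of `m`-currents on `M`: the linear functionals `T` on `𝒟^m(M)` which are
continuous, that is, `T α_j → 0` whenever `α_j → 0` (for linear functionals this sequential
condition is equivalent to continuity for the usual inductive limit topology of `𝒟^m(M)`). -/
def currents : Submodule ℝ (testForms n M m →ₗ[ℝ] ℝ) where
  carrier := {T | ∀ α : ℕ → testForms n M m, TendstoZero α →
    Tendsto (fun j => T (α j)) atTop (𝓝 0)}
  zero_mem' _ _ := tendsto_const_nhds
  add_mem' h₁ h₂ α hα := by simpa using (h₁ α hα).add (h₂ α hα)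
  smul_mem' c _ h α hα := by simpa using (h α hα).const_mul c

/-- The current `T` is of class `C^∞`: in every smooth chart it has `C^∞` coefficients, that is,
on forms `α` supported in the chart it is `T α = ∫ ∑_I f_I(y) α_I(y) dy`, where `α_I` are the
coefficients of `α` and `f_I` are `C^∞` functions (collected here into one `C^∞` function `f` with
values in the dual of the space of alternating forms). If `M` is oriented this says that
`T α = ∫_M β ∧ α` for a smooth `(n - m)`-form `β`, and in general that this holds for a smooth
`β` of odd kind (twisted by the orientation line bundle). -/
def IsSmoothCurrent (T : currents n m M) : Prop :=
  ∀ e ∈ IsManifold.maximalAtlas (𝓡 n) ∞ M,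
    ∃ f : EuclideanSpace ℝ (Fin n) → (EuclideanSpace ℝ (Fin n) [⋀^Fin m]→L[ℝ] ℝ) →L[ℝ] ℝ,
      ContDiffOn ℝ ∞ f e.target ∧
        ∀ α : testForms n M m, formSupport (α : FormField n M m) ⊆ e.source →
          T.1 α = ∫ y in e.target, f y (chartRep e (α : FormField n M m) y)

/-- The push-forward `f_* T`, given by `(f_* T)(α) = T (f^* α)`, as a linear functional on
`𝒟^m(M)`. -/
def pushforward [IsManifold (𝓡 n) ∞ M] (f : M ≃ₘ^∞⟮𝓡 n, 𝓡 n⟯ M) (T : currents n m M) :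
    testForms n M m →ₗ[ℝ] ℝ :=
  T.1 ∘ₗ pullback f

/-- For a Lie group `G` acting smoothly on `M`, the current `T` is `G`-invariant if `g_* T = T` for
the diffeomorphism `x ↦ g • x` of `M`, for every `g` in `G`. -/
def IsInvariantCurrent (k : ℕ) (G : Type*) [TopologicalSpace G]
    [ChartedSpace (EuclideanSpace ℝ (Fin k)) G] [Group G] [MulAction G M]
    [IsManifold (𝓡 n) ∞ M] [ContMDiffSMul (𝓡 k) (𝓡 n) ∞ G M] (T : currents n m M) : Prop :=
  ∀ g : G, pushforward (Diffeomorph.smul (𝓡 k) (𝓡 n) ∞ g) T = T.1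

end Currents

end DeRham

end

/-!
A partition of unity subordinate to charts writes a current `T` as a locally finite sum of pieces
living in single charts, and there each piece can be mollified: the mollified piece has the smooth
density `x ↦ T (φ_ε (x - ·))`. Summing over finitely many patches, more and more of them as
`ε → 0`, gives smooth currents `R_ε T` that converge to `T`, and even `R_ε T (α_ε) → T α` whenever
`α_ε → α` as test forms.

Averaging a current over the compact group against Haar measure makes it invariant and leaves
invariant currents unchanged. It preserves smoothness, by a change of variables and differentiation
under the integral sign. Since the convergence above tolerates moving test forms,
`R_ε T (g^* α) → T (g^* α)` locally uniformly in `g`, so the average of `R_ε T` converges to the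
average of `T`.
-/

noncomputable section

set_option maxSynthPendingDepth 3

namespace DeRham

open TopologicalSpace (Compacts)
open scoped Distributions BoundedContinuousFunction

/-! ### Smooth families of functions -/

theorem natCast_le_infty (r : ℕ) : (r : ℕ∞ω) ≤ ∞ := by exact_mod_cast le_top

theorem continuousOn_uncurry_comp {X P Y F : Type*} [TopologicalSpace X]
    [TopologicalSpace P] [TopologicalSpace Y] [TopologicalSpace F] {H : P → Y → F} {U : Set Y}
    (hH : ContinuousOn (Function.uncurry H) (univ ×ˢ U)) (ι : C(X, P)) :
    ContinuousOn (Function.uncurry fun x => H (ι x)) (univ ×ˢ U) :=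
  hH.comp (f := fun q : X × Y => (ι q.1, q.2)) (by fun_prop) fun _ hq => ⟨mem_univ _, hq.2⟩

section Slice

variable {X Y F : Type*} [TopologicalSpace X] [TopologicalSpace Y] [TopologicalSpace F] [Zero F]
  {H : X → Y → F} {U : Set Y}

open Classical in
/-- The curve of continuous functions `y ↦ H · y` attached to a family `H x` of functions of `y`;
its value is `0` at the points `y` for which `H · y` is not continuous. -/
def slice (H : X → Y → F) (y : Y) : C(X, F) :=
  if h : Continuous fun x => H x y then ⟨_, h⟩ else 0

theorem slice_apply (hH : ContinuousOn (Function.uncurry H) (univ ×ˢ U)) {y : Y} (hy : y ∈ U)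
    (x : X) : slice H y x = H x y := by
  have h : Continuous fun x => H x y :=
    hH.comp_continuous (f := fun x => (x, y)) (by fun_prop) fun x => ⟨mem_univ x, hy⟩
  rw [slice, dif_pos h, ContinuousMap.coe_mk]

theorem continuousOn_slice (hH : ContinuousOn (Function.uncurry H) (univ ×ˢ U)) :
    ContinuousOn (slice H) U := by
  refine continuousOn_iff_continuous_domRestrict.2
    (ContinuousMap.continuous_of_continuous_uncurry _ ?_)
  refine (hH.comp_continuous (f := fun q : U × X => (q.2, (q.1 : Y))) (by fun_prop)
    fun q => ⟨mem_univ _, q.1.2⟩).congr fun q => ?_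
  exact (slice_apply hH q.1.2 q.2).symm

end Slice

section SmoothFamilies

universe u

variable {V : Type*} [NormedAddCommGroup V] [NormedSpace ℝ V] {B : Type*} [TopologicalSpace B]
  {I : ModelWithCorners ℝ V B} {P : Type*} [TopologicalSpace P] [ChartedSpace B P]
  {E F : Type u} [NormedAddCommGroup E] [NormedSpace ℝ E] [NormedAddCommGroup F] [NormedSpace ℝ F]

theorem contDiffAt_of_contMDiffAt_uncurry {H : P → E → F} {q : P × E}
    (hH : ContMDiffAt (I.prod 𝓘(ℝ, E)) 𝓘(ℝ, F) ∞ (Function.uncurry H) q) :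
    ContDiffAt ℝ ∞ (H q.1) q.2 :=
  (ContMDiffAt.comp q.2 (g := Function.uncurry H) (f := fun y => (q.1, y)) hH
    (contMDiffAt_const.prodMk contMDiffAt_id)).contDiffAt

section

variable [IsManifold I ∞ P]

theorem contMDiffAt_fderiv_right {H : P → E → F} {q : P × E}
    (hH : ContMDiffAt (I.prod 𝓘(ℝ, E)) 𝓘(ℝ, F) ∞ (Function.uncurry H) q) :
    ContMDiffAt (I.prod 𝓘(ℝ, E)) 𝓘(ℝ, E →L[ℝ] F) ∞
      (fun q : P × E => fderiv ℝ (H q.1) q.2) q := by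
  have h2 : ContMDiffAt ((I.prod 𝓘(ℝ, E)).prod 𝓘(ℝ, E)) (I.prod 𝓘(ℝ, E)) ∞
      (fun w : (P × E) × E => (w.1.1, w.2)) (q, q.2) :=
    (contMDiffAt_fst.fst).prodMk contMDiffAt_snd
  have h := ContMDiffAt.mfderiv (J := I.prod 𝓘(ℝ, E)) (I := 𝓘(ℝ, E)) (I' := 𝓘(ℝ, F)) (x₀ := q)
    (m := ∞) (n := ∞) (fun (q : P × E) (y : E) => H q.1 y) Prod.snd
    (ContMDiffAt.comp (q, q.2) (g := Function.uncurry H) hH h2) contMDiffAt_snd (by simp)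
  simpa only [inTangentCoordinates_model_space, mfderiv_eq_fderiv] using h

theorem contMDiffOn_fderiv_right {H : P → E → F} {O : Set (P × E)} (hO : IsOpen O)
    (hH : ContMDiffOn (I.prod 𝓘(ℝ, E)) 𝓘(ℝ, F) ∞ (Function.uncurry H) O) :
    ContMDiffOn (I.prod 𝓘(ℝ, E)) 𝓘(ℝ, E →L[ℝ] F) ∞
      (fun q : P × E => fderiv ℝ (H q.1) q.2) O := fun _ hq =>
  (contMDiffAt_fderiv_right (hH.contMDiffAt (hO.mem_nhds hq))).contMDiffWithinAt

theorem contMDiffOn_iteratedFDeriv_right {H : P → E → F} {O : Set (P × E)} (hO : IsOpen O)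
    (hH : ContMDiffOn (I.prod 𝓘(ℝ, E)) 𝓘(ℝ, F) ∞ (Function.uncurry H) O) (j : ℕ) :
    ContMDiffOn (I.prod 𝓘(ℝ, E)) 𝓘(ℝ, E [×j]→L[ℝ] F) ∞
      (fun q : P × E => iteratedFDeriv ℝ j (H q.1) q.2) O := by
  induction j generalizing F with
  | zero =>
    exact (continuousMultilinearCurryFin0 ℝ E F).symm.contDiff.contMDiff.comp_contMDiffOn hH
  | succ j ih =>
    simp only [iteratedFDeriv_succ_eq_comp_right]
    exact (continuousMultilinearCurryRightEquiv' ℝ j E F).symm.contDiff.contMDiff.comp_contMDiffOn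
      (ih (H := fun p => fderiv ℝ (H p)) (contMDiffOn_fderiv_right hO hH))

end

variable {X : Type*} [TopologicalSpace X] [CompactSpace X]

/-- Evaluation at vectors, as a map from continuous functions with values in `E →L[ℝ] F` to
continuous linear maps into continuous functions. -/
def flipContinuousMap : C(X, E →L[ℝ] F) →L[ℝ] (E →L[ℝ] C(X, F)) :=
  LinearMap.mkContinuous₂
    (LinearMap.mk₂ ℝ (fun (f : C(X, E →L[ℝ] F)) (v : E) =>
        (⟨fun x => f x v, by fun_prop⟩ : C(X, F)))
      (fun f g v => by ext x; simp) (fun c f v => by ext x; simp)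
      (fun f v w => by ext x; simp) (fun c f v => by ext x; simp)) 1 fun f v => by
    rw [one_mul, ContinuousMap.norm_le _ (by positivity)]
    intro x
    exact ((f x).le_opNorm v).trans (by gcongr; exact f.norm_coe_le_norm x)

theorem flipContinuousMap_apply (f : C(X, E →L[ℝ] F)) (v : E) (x : X) :
    flipContinuousMap f v x = f x v := rfl

theorem hasFDerivAt_slice {H : X → E → F} {U : Set E} {H' : X → E → E →L[ℝ] F} (hU : IsOpen U)
    (hH : ContinuousOn (Function.uncurry H) (univ ×ˢ U))
    (hH' : ContinuousOn (Function.uncurry H') (univ ×ˢ U))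
    (hd : ∀ x, ∀ y ∈ U, HasFDerivAt (H x) (H' x y) y) {y : E} (hy : y ∈ U) :
    HasFDerivAt (slice H) (flipContinuousMap (slice H' y)) y := by
  rw [hasFDerivAt_iff_isLittleO, Asymptotics.isLittleO_iff]
  intro c hc
  have hcont := (continuousOn_slice hH').continuousAt (hU.mem_nhds hy)
  obtain ⟨δ, hδ, hball⟩ := Metric.mem_nhds_iff.1
    (inter_mem (hU.mem_nhds hy) (hcont.preimage_mem_nhds (Metric.closedBall_mem_nhds _ hc)))
  filter_upwards [Metric.ball_mem_nhds y hδ] with z hz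
  rw [ContinuousMap.norm_le _ (by positivity)]
  intro x
  have hbound : ∀ w ∈ Metric.ball y δ, ‖H' x w - H' x y‖ ≤ c := fun w hw => by
    rw [← slice_apply hH' (hball hw).1, ← slice_apply hH' hy, ← dist_eq_norm]
    exact (ContinuousMap.dist_apply_le_dist x).trans (hball hw).2
  have hmv := (convex_ball y δ).norm_image_sub_le_of_norm_hasFDerivWithin_le'
    (fun w hw => (hd x w (hball hw).1).hasFDerivWithinAt) hbound (Metric.mem_ball_self hδ) hz
  simpa only [ContinuousMap.sub_apply, flipContinuousMap_apply, slice_apply hH (hball hz).1,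
    slice_apply hH hy, slice_apply hH' hy] using hmv

section

variable [MeasurableSpace X] [OpensMeasurableSpace X] (μ : Measure X) [IsFiniteMeasure μ]

theorem integrable_of_compactSpace {A : Type*} [NormedAddCommGroup A] {f : X → A}
    (hf : Continuous f) : Integrable f μ :=
  hf.integrable_of_hasCompactSupport (.of_compactSpace f)

variable (F) in
/-- Integration of continuous functions on a compact space, as a continuous linear map. -/
def integralCompact : C(X, F) →L[ℝ] F :=
  LinearMap.mkContinuous
    { toFun f := ∫ x, f x ∂μ
      map_add' f g := integral_add (integrable_of_compactSpace μ f.continuous)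
        (integrable_of_compactSpace μ g.continuous)
      map_smul' c f := integral_smul c f } (μ.real univ) fun f => by
    rw [mul_comm]
    exact norm_integral_le_of_norm_le_const (.of_forall f.norm_coe_le_norm)

theorem integralCompact_slice {Y : Type*} [TopologicalSpace Y] {H : X → Y → F} {U : Set Y}
    (hH : ContinuousOn (Function.uncurry H) (univ ×ˢ U)) {y : Y} (hy : y ∈ U) :
    integralCompact F μ (slice H y) = ∫ x, H x y ∂μ :=
  integral_congr_ae (.of_forall (slice_apply hH hy))

end

section

variable [IsManifold I ∞ P] {H : P → E → F} {U : Set E} (ι : C(X, P))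

theorem contDiffOn_slice (hU : IsOpen U)
    (hH : ContMDiffOn (I.prod 𝓘(ℝ, E)) 𝓘(ℝ, F) ∞ (Function.uncurry H) (univ ×ˢ U)) :
    ContDiffOn ℝ ∞ (slice fun x => H (ι x)) U := by
  rw [contDiffOn_infty]
  intro r
  induction r generalizing F with
  | zero =>
    exact contDiffOn_zero.2 (continuousOn_slice (continuousOn_uncurry_comp hH.continuousOn ι))
  | succ r ih =>
    have hO : IsOpen ((univ : Set P) ×ˢ U) := isOpen_univ.prod hU
    have hH' := contMDiffOn_fderiv_right hO hH
    have hd : ∀ y ∈ U, HasFDerivAt (slice fun x => H (ι x))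
        (flipContinuousMap (slice (fun x => fderiv ℝ (H (ι x))) y)) y := fun y hy =>
      hasFDerivAt_slice hU (continuousOn_uncurry_comp hH.continuousOn ι)
        (continuousOn_uncurry_comp (H := fun p => fderiv ℝ (H p)) hH'.continuousOn ι)
        (fun x z hz => ((contDiffAt_of_contMDiffAt_uncurry (q := (ι x, z))
          (hH.contMDiffAt (hO.mem_nhds ⟨mem_univ _, hz⟩))).differentiableAt (by simp)).hasFDerivAt)
        hy
    push_cast
    refine (contDiffOn_succ_iff_fderiv_of_isOpen hU).2
      ⟨fun y hy => (hd y hy).differentiableAt.differentiableWithinAt, by simp, ?_⟩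
    exact ((flipContinuousMap (E := E) (F := F) (X := X)).contDiff.comp_contDiffOn
      (ih (H := fun p => fderiv ℝ (H p)) hH')).congr fun y hy => (hd y hy).fderiv

theorem iteratedFDeriv_slice_apply (hU : IsOpen U)
    (hH : ContMDiffOn (I.prod 𝓘(ℝ, E)) 𝓘(ℝ, F) ∞ (Function.uncurry H) (univ ×ˢ U)) (j : ℕ)
    {y : E} (hy : y ∈ U) (v : Fin j → E) (x : X) :
    iteratedFDeriv ℝ j (slice fun x => H (ι x)) y v x = iteratedFDeriv ℝ j (H (ι x)) y v := by
  have hc : ContDiffAt ℝ j (slice fun x => H (ι x)) y :=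
    ((contDiffOn_slice ι hU hH).contDiffAt (hU.mem_nhds hy)).of_le (natCast_le_infty j)
  have heval : ContinuousMap.evalCLM ℝ x ∘ (slice fun x => H (ι x)) =ᶠ[𝓝 y] H (ι x) := by
    filter_upwards [hU.mem_nhds hy] with z hz
    exact slice_apply (continuousOn_uncurry_comp hH.continuousOn ι) hz x
  rw [← (heval.iteratedFDeriv ℝ j).eq_of_nhds,
    ContinuousLinearMap.iteratedFDeriv_comp_left _ hc le_rfl]
  rfl

variable [MeasurableSpace X] [OpensMeasurableSpace X] (μ : Measure X) [IsFiniteMeasure μ]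

theorem contDiffOn_integral_of_compactSpace (hU : IsOpen U)
    (hH : ContMDiffOn (I.prod 𝓘(ℝ, E)) 𝓘(ℝ, F) ∞ (Function.uncurry H) (univ ×ˢ U)) :
    ContDiffOn ℝ ∞ (fun y => ∫ x, H (ι x) y ∂μ) U :=
  ((integralCompact F μ).contDiff.comp_contDiffOn (contDiffOn_slice ι hU hH)).congr fun _ hy =>
    (integralCompact_slice μ (continuousOn_uncurry_comp hH.continuousOn ι) hy).symm

theorem iteratedFDeriv_integral_of_compactSpace (hU : IsOpen U)
    (hH : ContMDiffOn (I.prod 𝓘(ℝ, E)) 𝓘(ℝ, F) ∞ (Function.uncurry H) (univ ×ˢ U)) (j : ℕ)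
    {y : E} (hy : y ∈ U) :
    iteratedFDeriv ℝ j (fun y => ∫ x, H (ι x) y ∂μ) y =
      ∫ x, iteratedFDeriv ℝ j (H (ι x)) y ∂μ := by
  have hc : ContDiffAt ℝ j (slice fun x => H (ι x)) y :=
    ((contDiffOn_slice ι hU hH).contDiffAt (hU.mem_nhds hy)).of_le (natCast_le_infty j)
  have hint : (fun y => ∫ x, H (ι x) y ∂μ) =ᶠ[𝓝 y]
      integralCompact F μ ∘ slice fun x => H (ι x) := by
    filter_upwards [hU.mem_nhds hy] with z hz
    exact (integralCompact_slice μ (continuousOn_uncurry_comp hH.continuousOn ι) hz).symm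
  have hcont : Continuous fun x => iteratedFDeriv ℝ j (H (ι x)) y :=
    (contMDiffOn_iteratedFDeriv_right (isOpen_univ.prod hU) hH j).continuousOn.comp_continuous
      (f := fun x => (ι x, y)) (by fun_prop) fun x => ⟨mem_univ _, hy⟩
  rw [(hint.iteratedFDeriv ℝ j).eq_of_nhds,
    ContinuousLinearMap.iteratedFDeriv_comp_left _ hc le_rfl]
  ext v
  rw [ContinuousMultilinearMap.integral_apply (integrable_of_compactSpace μ hcont)]
  exact integral_congr_ae (.of_forall (iteratedFDeriv_slice_apply ι hU hH j hy v))

end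

end SmoothFamilies

/-! ### Convergence of jets -/

section JetsTendstoZero

universe u

variable {κ : Type*} {l : Filter κ}
  {E F F' : Type u} [NormedAddCommGroup E] [NormedSpace ℝ E] [NormedAddCommGroup F]
  [NormedSpace ℝ F] [NormedAddCommGroup F'] [NormedSpace ℝ F'] {u v : κ → E → F} {y₀ : E}

theorem eventually_eventually_prod_nhds {Y : Type*} [TopologicalSpace Y] {y₀ : Y}
    {p : κ → Y → Prop} (h : ∀ᶠ w in l ×ˢ 𝓝 y₀, p w.1 w.2) :
    ∀ᶠ w in l ×ˢ 𝓝 y₀, ∀ᶠ y in 𝓝 w.2, p w.1 y := by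
  obtain ⟨pa, ha, pb, hb, hp⟩ := eventually_prod_iff.1 h
  filter_upwards [ha.prod_mk (eventually_eventually_nhds.2 hb)] with w hw
  exact hw.2.mono fun y hy => hp hw.1 hy

/-- The functions `u k` are `C^∞` near `y₀` and tend to `0` along `l` together with all their
derivatives, uniformly near `y₀` in the sense that the limits are taken along `l ×ˢ 𝓝 y₀`. -/
structure JetsTendstoZero (l : Filter κ) (u : κ → E → F) (y₀ : E) : Prop where
  contDiffAt : ∀ᶠ w in l ×ˢ 𝓝 y₀, ContDiffAt ℝ ∞ (u w.1) w.2
  tendsto_iteratedFDeriv (r : ℕ) :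
    Tendsto (fun w : κ × E => iteratedFDeriv ℝ r (u w.1) w.2) (l ×ˢ 𝓝 y₀) (𝓝 0)

namespace JetsTendstoZero

theorem congr (h : JetsTendstoZero l u y₀) (huv : ∀ᶠ w in l ×ˢ 𝓝 y₀, u w.1 w.2 = v w.1 w.2) :
    JetsTendstoZero l v y₀ := by
  have huv' := eventually_eventually_prod_nhds (p := fun k y => u k y = v k y) huv
  refine ⟨?_, fun r => (h.tendsto_iteratedFDeriv r).congr' ?_⟩
  · filter_upwards [h.contDiffAt, huv'] with w hw huw
    exact hw.congr_of_eventuallyEq (huw.mono fun _ => Eq.symm)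
  · filter_upwards [huv'] with w huw
    exact (EventuallyEq.iteratedFDeriv ℝ huw r).eq_of_nhds

theorem of_eventually_eq_zero (h : ∀ᶠ y in 𝓝 y₀, ∀ k, u k y = 0) : JetsTendstoZero l u y₀ :=
  have hzero : JetsTendstoZero l (fun (_ : κ) (_ : E) => (0 : F)) y₀ :=
    ⟨.of_forall fun _ => contDiffAt_const, fun _ =>
      tendsto_const_nhds.congr fun w => (congrFun iteratedFDeriv_fun_zero w.2).symm⟩
  hzero.congr <| (tendsto_snd.eventually h).mono fun w hw => (hw w.1).symm

theorem comp_tendsto {κ' : Type*} {l' : Filter κ'} {φ : κ' → κ} (h : JetsTendstoZero l u y₀)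
    (hφ : Tendsto φ l' l) : JetsTendstoZero l' (fun k => u (φ k)) y₀ :=
  have hφ' := hφ.prodMap (tendsto_id (x := 𝓝 y₀))
  ⟨hφ'.eventually h.contDiffAt, fun r => (h.tendsto_iteratedFDeriv r).comp hφ'⟩

protected theorem fderiv (h : JetsTendstoZero l u y₀) :
    JetsTendstoZero l (fun k => fderiv ℝ (u k)) y₀ := by
  refine ⟨h.contDiffAt.mono fun w hw => hw.fderiv_right (by simp), fun r => ?_⟩
  have h := ((continuousMultilinearCurryRightEquiv' ℝ r E F).continuous.tendsto 0).comp
    (h.tendsto_iteratedFDeriv (r + 1))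
  rw [map_zero] at h
  refine h.congr fun w => ?_
  rw [Function.comp_apply, iteratedFDeriv_succ_eq_comp_right, Function.comp_apply,
    LinearIsometryEquiv.apply_symm_apply]

theorem tendsto (h : JetsTendstoZero l u y₀) :
    Tendsto (fun w : κ × E => u w.1 w.2) (l ×ˢ 𝓝 y₀) (𝓝 0) := by
  have h0 := ((continuousMultilinearCurryFin0 ℝ E F).continuous.tendsto 0).comp
    (h.tendsto_iteratedFDeriv 0)
  rw [map_zero] at h0
  exact h0.congr fun w => by simp [iteratedFDeriv_zero_eq_comp]

theorem tendsto_prodMk_comp {Y P : Type*} [TopologicalSpace Y] [TopologicalSpace P] {π : κ → P}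
    {p₀ : P} {θ : P → Y → Y} {y₀ : Y} (hπ : Tendsto π l (𝓝 p₀))
    (hθ : ContinuousAt (Function.uncurry θ) (p₀, y₀)) :
    Tendsto (fun w : κ × Y => (w.1, θ (π w.1) w.2)) (l ×ˢ 𝓝 y₀) (l ×ˢ 𝓝 (θ p₀ y₀)) :=
  tendsto_fst.prodMk (hθ.tendsto.comp ((hπ.comp tendsto_fst).prodMk_nhds tendsto_snd))

section Substitution

variable {V : Type*} [NormedAddCommGroup V] [NormedSpace ℝ V] {B : Type*} [TopologicalSpace B]
  {I : ModelWithCorners ℝ V B} {P : Type*} [TopologicalSpace P] [ChartedSpace B P]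
  {π : κ → P} {p₀ : P} {A : P → E → F →L[ℝ] F'} {θ : P → E → E} {O : Set (P × E)}

theorem contDiffAt_substitution (hu : ∀ᶠ w in l ×ˢ 𝓝 (θ p₀ y₀), ContDiffAt ℝ ∞ (u w.1) w.2)
    (hπ : Tendsto π l (𝓝 p₀)) (hO : IsOpen O) (hO₀ : (p₀, y₀) ∈ O)
    (hA : ContMDiffOn (I.prod 𝓘(ℝ, E)) 𝓘(ℝ, F →L[ℝ] F') ∞ (Function.uncurry A) O)
    (hθ : ContMDiffOn (I.prod 𝓘(ℝ, E)) 𝓘(ℝ, E) ∞ (Function.uncurry θ) O) :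
    ∀ᶠ w in l ×ˢ 𝓝 y₀, ContDiffAt ℝ ∞ (A (π w.1)) w.2 ∧ ContDiffAt ℝ ∞ (θ (π w.1)) w.2 ∧
      ContDiffAt ℝ ∞ (u w.1) (θ (π w.1) w.2) := by
  filter_upwards [((hπ.comp tendsto_fst).prodMk_nhds tendsto_snd).eventually (hO.mem_nhds hO₀),
    (tendsto_prodMk_comp hπ
      (hθ.continuousOn.continuousAt (hO.mem_nhds hO₀))).eventually hu] with w hw huw
  exact ⟨contDiffAt_of_contMDiffAt_uncurry (q := (π w.1, w.2)) (hA.contMDiffAt (hO.mem_nhds hw)),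
    contDiffAt_of_contMDiffAt_uncurry (q := (π w.1, w.2)) (hθ.contMDiffAt (hO.mem_nhds hw)), huw⟩

theorem fderiv_clm_apply_comp {A : E → F →L[ℝ] F'} {θ : E → E} {u : E → F} {y : E}
    (hA : DifferentiableAt ℝ A y) (hθ : DifferentiableAt ℝ θ y)
    (hu : DifferentiableAt ℝ u (θ y)) :
    fderiv ℝ (fun y => A y (u (θ y))) y = (fderiv ℝ A y).flip (u (θ y)) +
      (ContinuousLinearMap.compL ℝ E F F' (A y)).comp
        ((ContinuousLinearMap.compL ℝ E E F).flip (fderiv ℝ θ y))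
        (fderiv ℝ u (θ y)) :=
  (hA.hasFDerivAt.clm_apply (hu.hasFDerivAt.comp y hθ.hasFDerivAt)).fderiv.trans
    (add_comm _ _)

theorem iteratedFDeriv_succ_clm_apply_comp {A : E → F →L[ℝ] F'} {θ : E → E} {u : E → F} {y : E}
    (hA : ContDiffAt ℝ ∞ A y) (hθ : ContDiffAt ℝ ∞ θ y) (hu : ContDiffAt ℝ ∞ u (θ y)) (r : ℕ) :
    iteratedFDeriv ℝ (r + 1) (fun y => A y (u (θ y))) y =
      (continuousMultilinearCurryRightEquiv' ℝ r E F').symm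
        (iteratedFDeriv ℝ r (fun y => (fderiv ℝ A y).flip (u (θ y))) y +
          iteratedFDeriv ℝ r (fun y => (ContinuousLinearMap.compL ℝ E F F' (A y)).comp
            ((ContinuousLinearMap.compL ℝ E E F).flip (fderiv ℝ θ y)) (fderiv ℝ u (θ y))) y) := by
  have hnear {W : Type u} [NormedAddCommGroup W] [NormedSpace ℝ W] {f : E → W} {z : E}
      (hf : ContDiffAt ℝ ∞ f z) : ∀ᶠ y in 𝓝 z, DifferentiableAt ℝ f y :=
    ((hf.of_le (natCast_le_infty 1)).eventually (by simp)).mono fun y hy =>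
      hy.differentiableAt (by simp)
  have hfderiv : (fderiv ℝ fun y => A y (u (θ y))) =ᶠ[𝓝 y] fun y =>
      (fderiv ℝ A y).flip (u (θ y)) + (ContinuousLinearMap.compL ℝ E F F' (A y)).comp
        ((ContinuousLinearMap.compL ℝ E E F).flip (fderiv ℝ θ y)) (fderiv ℝ u (θ y)) := by
    filter_upwards [hnear hA, hnear hθ, hθ.continuousAt.eventually (hnear hu)] with z hAz hθz huz
    exact fderiv_clm_apply_comp hAz hθz huz
  have hsmooth₁ : ContDiffAt ℝ ∞ (fun y => (fderiv ℝ A y).flip (u (θ y))) y :=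
    ((ContinuousLinearMap.flipₗᵢ ℝ E F F').contDiff.contDiffAt.comp y
      (hA.fderiv_right (by simp))).clm_apply (hu.comp y hθ)
  have hsmooth₂ : ContDiffAt ℝ ∞ (fun y => (ContinuousLinearMap.compL ℝ E F F' (A y)).comp
      ((ContinuousLinearMap.compL ℝ E E F).flip (fderiv ℝ θ y)) (fderiv ℝ u (θ y))) y :=
    (((ContinuousLinearMap.contDiff _).contDiffAt.comp y hA).clm_comp
      ((ContinuousLinearMap.contDiff _).contDiffAt.comp y
        (hθ.fderiv_right (by simp)))).clm_apply ((hu.fderiv_right (by simp)).comp y hθ)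
  rw [iteratedFDeriv_succ_eq_comp_right, Function.comp_apply,
    (hfderiv.iteratedFDeriv ℝ r).eq_of_nhds]
  exact congrArg _ (iteratedFDeriv_add_apply (hsmooth₁.of_le (natCast_le_infty r))
    (hsmooth₂.of_le (natCast_le_infty r)))

variable [IsManifold I ∞ P]

theorem tendsto_iteratedFDeriv_substitution (r : ℕ)
    (hu : JetsTendstoZero l u (θ p₀ y₀)) (hπ : Tendsto π l (𝓝 p₀))
    (hO : IsOpen O) (hO₀ : (p₀, y₀) ∈ O)
    (hA : ContMDiffOn (I.prod 𝓘(ℝ, E)) 𝓘(ℝ, F →L[ℝ] F') ∞ (Function.uncurry A) O)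
    (hθ : ContMDiffOn (I.prod 𝓘(ℝ, E)) 𝓘(ℝ, E) ∞ (Function.uncurry θ) O) :
    Tendsto (fun w : κ × E =>
        iteratedFDeriv ℝ r (fun y => A (π w.1) y (u w.1 (θ (π w.1) y))) w.2)
      (l ×ˢ 𝓝 y₀) (𝓝 0) := by
  induction r generalizing F F' with
  | zero =>
    have hA₀ := (hA.continuousOn.continuousAt (hO.mem_nhds hO₀)).tendsto.comp
      ((hπ.comp tendsto_fst).prodMk_nhds (tendsto_snd (f := l) (g := 𝓝 y₀)))
    have h := (isBoundedBilinearMap_apply.continuous.tendsto _).comp (hA₀.prodMk_nhds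
      (hu.tendsto.comp (tendsto_prodMk_comp hπ
        (hθ.continuousOn.continuousAt (hO.mem_nhds hO₀)))))
    simp only [map_zero] at h
    have h' := ((continuousMultilinearCurryFin0 ℝ E F').symm.continuous.tendsto 0).comp h
    rwa [map_zero] at h'
  | succ r ih =>
    have hA₁ : ContMDiffOn (I.prod 𝓘(ℝ, E)) 𝓘(ℝ, F →L[ℝ] E →L[ℝ] F') ∞
        (fun q : P × E => (fderiv ℝ (A q.1) q.2).flip) O :=
      (ContinuousLinearMap.flipₗᵢ ℝ E F F').contDiff.contMDiff.comp_contMDiffOn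
        (contMDiffOn_fderiv_right hO hA)
    have hA₂ : ContMDiffOn (I.prod 𝓘(ℝ, E)) 𝓘(ℝ, (E →L[ℝ] F) →L[ℝ] E →L[ℝ] F') ∞
        (fun q : P × E => (ContinuousLinearMap.compL ℝ E F F' (A q.1 q.2)).comp
          ((ContinuousLinearMap.compL ℝ E E F).flip (fderiv ℝ (θ q.1) q.2))) O :=
      ((ContinuousLinearMap.contDiff _).contMDiff.comp_contMDiffOn hA).clm_comp
        ((ContinuousLinearMap.contDiff _).contMDiff.comp_contMDiffOn
          (contMDiffOn_fderiv_right hO hθ))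
    have h := (ih hu (A := fun p y => (fderiv ℝ (A p) y).flip) hA₁).add
      (ih hu.fderiv (A := fun p y => (ContinuousLinearMap.compL ℝ E F F' (A p y)).comp
          ((ContinuousLinearMap.compL ℝ E E F).flip (fderiv ℝ (θ p) y))) hA₂)
    have h' := ((continuousMultilinearCurryRightEquiv' ℝ r E F').symm.continuous.tendsto _).comp h
    rw [add_zero, map_zero] at h'
    refine h'.congr' ?_
    filter_upwards [contDiffAt_substitution hu.contDiffAt hπ hO hO₀ hA hθ] with w ⟨hAw, hθw, huw⟩
    exact (iteratedFDeriv_succ_clm_apply_comp hAw hθw huw r).symm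

theorem substitution (hu : JetsTendstoZero l u (θ p₀ y₀)) (hπ : Tendsto π l (𝓝 p₀))
    (hO : IsOpen O) (hO₀ : (p₀, y₀) ∈ O)
    (hA : ContMDiffOn (I.prod 𝓘(ℝ, E)) 𝓘(ℝ, F →L[ℝ] F') ∞ (Function.uncurry A) O)
    (hθ : ContMDiffOn (I.prod 𝓘(ℝ, E)) 𝓘(ℝ, E) ∞ (Function.uncurry θ) O) :
    JetsTendstoZero l (fun k y => A (π k) y (u k (θ (π k) y))) y₀ :=
  ⟨(contDiffAt_substitution hu.contDiffAt hπ hO hO₀ hA hθ).mono fun w hw =>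
      hw.1.clm_apply (hw.2.2.comp w.2 hw.2.1),
    fun r => tendsto_iteratedFDeriv_substitution r hu hπ hO hO₀ hA hθ⟩

theorem sub_of_contMDiffOn {H : P → E → F} (hO : IsOpen O) (hO₀ : (p₀, y₀) ∈ O)
    (hH : ContMDiffOn (I.prod 𝓘(ℝ, E)) 𝓘(ℝ, F) ∞ (Function.uncurry H) O) :
    JetsTendstoZero (𝓝 p₀) (fun p => H p - H p₀) y₀ := by
  have hH₀ : ContMDiffOn (I.prod 𝓘(ℝ, E)) 𝓘(ℝ, F) ∞ (fun q : P × E => H p₀ q.2)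
      ((fun q : P × E => (p₀, q.2)) ⁻¹' O) :=
    hH.comp (contMDiff_const.prodMk contMDiff_snd).contMDiffOn subset_rfl
  have hO' : IsOpen ((fun q : P × E => (p₀, q.2)) ⁻¹' O) := hO.preimage (by fun_prop)
  have hsmooth : ∀ᶠ w in 𝓝 p₀ ×ˢ 𝓝 y₀, ContDiffAt ℝ ∞ (H w.1) w.2 ∧ ContDiffAt ℝ ∞ (H p₀) w.2 := by
    rw [← nhds_prod_eq]
    filter_upwards [hO.mem_nhds hO₀, hO'.mem_nhds hO₀] with w hw hw'
    exact ⟨contDiffAt_of_contMDiffAt_uncurry (hH.contMDiffAt (hO.mem_nhds hw)),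
      contDiffAt_of_contMDiffAt_uncurry (hH.contMDiffAt (hO.mem_nhds hw'))⟩
  refine ⟨hsmooth.mono fun w hw => hw.1.sub hw.2, fun r => ?_⟩
  have h := ((contMDiffOn_iteratedFDeriv_right hO hH r).continuousOn.continuousAt
    (hO.mem_nhds hO₀)).tendsto.sub
    ((contMDiffOn_iteratedFDeriv_right hO' (H := fun _ => H p₀) hH₀ r).continuousOn.continuousAt
      (hO'.mem_nhds hO₀)).tendsto
  rw [sub_self, nhds_prod_eq] at h
  refine h.congr' (hsmooth.mono fun w hw => ?_)
  exact (iteratedFDeriv_sub_apply (hw.1.of_le (natCast_le_infty r))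
    (hw.2.of_le (natCast_le_infty r))).symm

end Substitution

end JetsTendstoZero

end JetsTendstoZero

/-! ### Continuous functionals on spaces of test functions -/

section Functionals

universe u

variable {E F : Type u} [NormedAddCommGroup E] [NormedSpace ℝ E] [NormedAddCommGroup F]
  [NormedSpace ℝ F] {K : Compacts E}

theorem tendsto_zero_iff_jetsTendstoZero {κ : Type*} {l : Filter κ} {u : κ → 𝓓_{K}(E, F)} :
    Tendsto u l (𝓝 0) ↔ ∀ y, JetsTendstoZero l (fun k => u k) y := by
  have hN := ContDiffMapSupportedIn.withSeminorms ℝ E F ⊤ K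
  constructor
  · refine fun hu y => ⟨.of_forall fun w => (u w.1).contDiff.contDiffAt, fun r => ?_⟩
    have hr : Tendsto (fun w : κ × E => N[ℝ]_{K, r} (u w.1)) (l ×ˢ 𝓝 y) (𝓝 0) := by
      have h := ((hN.continuous_seminorm r).tendsto 0).comp (hu.comp (tendsto_fst (g := 𝓝 y)))
      rwa [map_zero] at h
    exact squeeze_zero_norm (fun w =>
      ContDiffMapSupportedIn.norm_iteratedFDeriv_apply_le_seminorm_top ℝ) hr
  · intro h
    refine (hN.tendsto_nhds u 0).2 fun r ε hε => ?_
    have hK : ∀ᶠ w in l ×ˢ 𝓝ˢ (K : Set E), ‖iteratedFDeriv ℝ r (u w.1) w.2‖ < ε / 2 :=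
      K.isCompact.mem_prod_nhdsSet_of_forall fun y _ =>
        ((h y).tendsto_iteratedFDeriv r).norm.eventually_lt_const (by simpa using half_pos hε)
    obtain ⟨pa, ha, pb, hb, hp⟩ := eventually_prod_iff.1 hK
    filter_upwards [ha] with k hk
    rw [sub_zero]
    refine ((ContDiffMapSupportedIn.seminorm_top_le_iff ℝ (half_pos hε).le r (u k)).2
      fun x hx => ?_).trans_lt (half_lt_self hε)
    exact (hp hk (subset_of_mem_nhdsSet hb hx)).le

theorem exists_clm_comp_eq_of_abs_le {X Y : Type*} [AddCommGroup X] [Module ℝ X]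
    [NormedAddCommGroup Y] [NormedSpace ℝ Y] (J : X →ₗ[ℝ] Y) (t : X →ₗ[ℝ] ℝ) {C : ℝ}
    (h : ∀ x, |t x| ≤ C * ‖J x‖) : ∃ Φ : Y →L[ℝ] ℝ, ∀ x, t x = Φ (J x) := by
  obtain ⟨s, hs⟩ := J.rangeRestrict.exists_rightInverse_of_surjective
    (LinearMap.range_eq_top.2 J.surjective_rangeRestrict)
  have hJs : ∀ y : LinearMap.range J, J (s y) = y := fun y =>
    congrArg Subtype.val (LinearMap.congr_fun hs y)
  obtain ⟨Φ, hΦ, -⟩ := exists_extension_norm_eq (𝕜 := ℝ) (LinearMap.range J)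
    ((t ∘ₗ s).mkContinuous C fun y => by simpa [hJs] using h (s y))
  refine ⟨Φ, fun x => Eq.trans ?_ (hΦ ⟨J x, x, rfl⟩).symm⟩
  have hx := h (x - s ⟨J x, x, rfl⟩)
  rw [map_sub, map_sub, hJs, sub_self, norm_zero, mul_zero] at hx
  exact sub_eq_zero.1 (abs_nonpos_iff.1 hx)

variable (E F) in
/-- The space of `r`-jets of functions `E → F` at a point. -/
abbrev Jet (r : ℕ) : Type u := Π i : Fin (r + 1), E [×i]→L[ℝ] F

/-- The `r`-jets of a test function supported in `K`, as a continuous function on `K`. -/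
def jetOn (r : ℕ) : 𝓓_{K}(E, F) →ₗ[ℝ] C(K, Jet E F r) where
  toFun u := ⟨fun x i => iteratedFDeriv ℝ i u x, continuous_pi fun i =>
    (u.contDiff.continuous_iteratedFDeriv (natCast_le_infty i)).comp
      continuous_subtype_val⟩
  map_add' u v := by
    ext1 x
    exact funext fun i => iteratedFDeriv_add_apply
      (u.contDiff.contDiffAt.of_le (natCast_le_infty i))
      (v.contDiff.contDiffAt.of_le (natCast_le_infty i))
  map_smul' c u := by
    ext1 x
    exact funext fun i => iteratedFDeriv_const_smul_apply
      (u.contDiff.contDiffAt.of_le (natCast_le_infty i))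

theorem jetOn_apply (r : ℕ) (u : 𝓓_{K}(E, F)) (x : K) (i : Fin (r + 1)) :
    jetOn r u x i = iteratedFDeriv ℝ i u x := rfl

theorem exists_clm_comp_jetOn_eq (T : 𝓓_{K}(E, F) →L[ℝ] ℝ) :
    ∃ (r : ℕ) (Φ : C(K, Jet E F r) →L[ℝ] ℝ), ∀ u, T u = Φ (jetOn r u) := by
  obtain ⟨s, C, -, hC⟩ := Seminorm.bound_of_continuous
    (ContDiffMapSupportedIn.withSeminorms ℝ E F ⊤ K) ((normSeminorm ℝ ℝ).comp T.toLinearMap)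
    T.continuous.norm
  refine ⟨s.sup id, exists_clm_comp_eq_of_abs_le (jetOn (s.sup id)) T.toLinearMap (C := C)
    fun u => (hC u).trans ?_⟩
  refine mul_le_mul_of_nonneg_left (Seminorm.finset_sup_apply_le (norm_nonneg _) fun i hi => ?_)
    C.2
  refine (ContDiffMapSupportedIn.seminorm_top_le_iff ℝ (norm_nonneg _) i u).2 fun x hx => ?_
  exact (norm_le_pi_norm (jetOn (s.sup id) u ⟨x, hx⟩)
    ⟨i, Nat.lt_succ_of_le (Finset.le_sup (f := id) hi)⟩).trans
    ((jetOn (s.sup id) u).norm_coe_le_norm ⟨x, hx⟩)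

theorem contDiff_clm_apply_kernel {Z : Type u} [NormedAddCommGroup Z] [NormedSpace ℝ Z]
    (T : 𝓓_{K}(E, F) →L[ℝ] ℝ) {u : Z → 𝓓_{K}(E, F)}
    (hu : ContDiff ℝ ∞ fun q : Z × E => u q.1 q.2) : ContDiff ℝ ∞ fun z => T (u z) := by
  obtain ⟨r, Φ, hΦ⟩ := exists_clm_comp_jetOn_eq T
  let H (x : E) (z : Z) : Jet E F r := fun i => iteratedFDeriv ℝ i (u z) x
  have hH : ContMDiff (𝓘(ℝ, E).prod 𝓘(ℝ, Z)) 𝓘(ℝ, Jet E F r) ∞ (Function.uncurry H) := by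
    refine contMDiff_pi_space.2 fun i => ?_
    have hu' : ContMDiff (𝓘(ℝ, Z).prod 𝓘(ℝ, E)) 𝓘(ℝ, F) ∞ (fun q : Z × E => u q.1 q.2) := by
      have h := hu.contMDiff
      rwa [modelWithCornersSelf_prod, ← chartedSpaceSelf_prod] at h
    have h := contMDiffOn_iteratedFDeriv_right isOpen_univ (H := fun z => u z) hu'.contMDiffOn i
    exact (contMDiffOn_univ.1 h).comp (contMDiff_snd.prodMk contMDiff_fst)
  let ι : C(K, E) := ⟨_, continuous_subtype_val⟩
  have hslice := contDiffOn_slice ι isOpen_univ (hH.contMDiffOn (s := univ ×ˢ univ))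
  convert Φ.contDiff.comp (contDiffOn_univ.1 hslice) using 1
  funext z
  rw [hΦ]
  refine congrArg Φ (ContinuousMap.ext fun x => Eq.symm ?_)
  exact slice_apply (continuousOn_uncurry_comp hH.continuous.continuousOn ι) (mem_univ z) x

theorem clm_integral_of_compactSpace [CompleteSpace F]
    {V : Type*} [NormedAddCommGroup V] [NormedSpace ℝ V]
    {B : Type*} [TopologicalSpace B] {I : ModelWithCorners ℝ V B} {P : Type*} [TopologicalSpace P]
    [ChartedSpace B P] [IsManifold I ∞ P] {X : Type*} [TopologicalSpace X] [CompactSpace X]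
    [MeasurableSpace X] [OpensMeasurableSpace X] (μ : Measure X) [IsFiniteMeasure μ] (ι : C(X, P))
    (T : 𝓓_{K}(E, F) →L[ℝ] ℝ) {u : P → 𝓓_{K}(E, F)}
    (hu : ContMDiff (I.prod 𝓘(ℝ, E)) 𝓘(ℝ, F) ∞ fun q : P × E => u q.1 q.2)
    {w : 𝓓_{K}(E, F)} (hw : ∀ y, w y = ∫ x, u (ι x) y ∂μ) :
    T w = ∫ x, T (u (ι x)) ∂μ := by
  obtain ⟨r, Φ, hΦ⟩ := exists_clm_comp_jetOn_eq T
  have hO : ContMDiffOn (I.prod 𝓘(ℝ, E)) 𝓘(ℝ, F) ∞ (Function.uncurry fun p => ⇑(u p))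
    (univ ×ˢ univ) := hu.contMDiffOn
  have hjet : Continuous fun p => jetOn r (u p) := by
    refine ContinuousMap.continuous_of_continuous_uncurry _ (continuous_pi fun i => ?_)
    have h := (contMDiffOn_iteratedFDeriv_right (isOpen_univ.prod isOpen_univ) hO i).continuousOn
    exact h.comp_continuous (f := fun q : P × K => (q.1, (q.2 : E))) (by fun_prop) fun _ => by simp
  have hint : Integrable (fun x => jetOn r (u (ι x))) μ :=
    integrable_of_compactSpace μ (hjet.comp ι.continuous)
  simp only [hΦ]
  rw [Φ.integral_comp_comm hint]
  refine congrArg Φ (ContinuousMap.ext fun y => funext fun i => ?_)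
  have hjet_y : Continuous fun x => jetOn r (u (ι x)) y :=
    (ContinuousMap.evalCLM ℝ y).continuous.comp (hjet.comp ι.continuous)
  have heval : (∫ x, jetOn r (u (ι x)) ∂μ) y i = ∫ x, jetOn r (u (ι x)) y i ∂μ := by
    refine (congrFun ((ContinuousMap.evalCLM ℝ y).integral_comp_comm hint).symm i).trans ?_
    exact eval_integral (fun i => integrable_of_compactSpace μ
      ((continuous_apply i).comp hjet_y)) i
  rw [heval, jetOn_apply, funext hw]
  exact iteratedFDeriv_integral_of_compactSpace ι μ isOpen_univ hO i (mem_univ _)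

end Functionals

/-! ### Differential forms in charts -/

/-- The model space `ℝⁿ`. -/
abbrev Euc (n : ℕ) : Type := EuclideanSpace ℝ (Fin n)

/-- The space of alternating `m`-linear forms on `ℝⁿ`. -/
abbrev Alt (n m : ℕ) : Type := Euc n [⋀^Fin m]→L[ℝ] ℝ

instance finiteDimensional_alt (n m : ℕ) : FiniteDimensional ℝ (Alt n m) :=
  Module.Finite.of_injective
    ((ContinuousMultilinearMap.toMultilinearMapLinear :
      ContinuousMultilinearMap ℝ (fun _ : Fin m => Euc n) ℝ →ₗ[ℝ]
        MultilinearMap ℝ (fun _ : Fin m => Euc n) ℝ) ∘ₗ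
      (ContinuousAlternatingMap.toContinuousMultilinearMapCLM ℝ).toLinearMap)
    (ContinuousMultilinearMap.toMultilinearMap_injective.comp
      ContinuousAlternatingMap.toContinuousMultilinearMap_injective)

theorem contDiff_compContinuousLinearMapCLM (n m : ℕ) :
    ContDiff ℝ ∞ (fun A : Euc n →L[ℝ] Euc n =>
      (ContinuousAlternatingMap.compContinuousLinearMapCLM A : Alt n m →L[ℝ] Alt n m)) :=
  contDiff_clm_apply_iff.2 fun a => (contDiff_compContinuousLinearMap n m).comp
    ((contDiff_const (c := a)).prodMk contDiff_id)

section Charts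

variable {n m : ℕ} {M : Type*} [TopologicalSpace M]

variable {e e' : OpenPartialHomeomorph M (Euc n)} {L : Compacts (Euc n)}

theorem isOpen_overlap (e e' : OpenPartialHomeomorph M (Euc n)) :
    IsOpen (e.target ∩ e.symm ⁻¹' e'.source) :=
  e.symm.isOpen_inter_preimage e'.open_source

theorem isCompact_symm_image (hLe : ↑L ⊆ e.target) : IsCompact (e.symm '' L) :=
  L.isCompact.image_of_continuousOn (e.continuousOn_symm.mono hLe)

theorem eventually_symm_notMem_image [T2Space M] (hLe : ↑L ⊆ e.target) {y : Euc n}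
    (hy : y ∈ e'.target) (hyL : e'.symm y ∉ e.symm '' L) : ∀ᶠ z in 𝓝 y, e'.symm z ∉ e.symm '' L :=
  (e'.continuousAt_symm hy).preimage_mem_nhds
    ((isCompact_symm_image hLe).isClosed.isOpen_compl.mem_nhds hyL)

variable [ChartedSpace (Euc n) M]

theorem apply_congr_point (α : FormField n M m) {p q : M} {v w : Fin m → Euc n} (hpq : p = q)
    (hvw : v = w) : (α p : (Fin m → Euc n) → ℝ) v = (α q : (Fin m → Euc n) → ℝ) w := by
  subst hpq hvw
  rfl

theorem contMDiffAt_symm_of_mem (he : e ∈ IsManifold.maximalAtlas (𝓡 n) ∞ M) {y : Euc n}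
    (hy : y ∈ e.target) : ContMDiffAt (𝓡 n) (𝓡 n) ∞ e.symm y :=
  (contMDiffOn_symm_of_mem_maximalAtlas he).contMDiffAt (e.open_target.mem_nhds hy)

theorem contMDiffAt_of_mem (he : e ∈ IsManifold.maximalAtlas (𝓡 n) ∞ M) {x : M}
    (hx : x ∈ e.source) : ContMDiffAt (𝓡 n) (𝓡 n) ∞ e x :=
  (contMDiffOn_of_mem_maximalAtlas he).contMDiffAt (e.open_source.mem_nhds hx)

theorem pullbackField_id (α : FormField n M m) : pullbackField id α = α := by
  funext x
  ext v
  simp [pullbackField]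

theorem chartRep_eq_zero {α : FormField n M m} {y : Euc n} (h : α (e.symm y) = 0) :
    chartRep e α y = 0 := by
  rw [chartRep, h]
  ext v
  rfl

theorem notMem_formSupport {α : FormField n M m} {x : M} (h : x ∉ formSupport α) : α x = 0 := by
  by_contra h'
  exact h (subset_closure h')

open Classical in
/-- The form on `M` which vanishes outside the domain of the chart `e` and whose expression in
this chart is `u`. -/
def formOf (e : OpenPartialHomeomorph M (Euc n)) (u : Euc n → Alt n m) : FormField n M m :=
  fun x => if x ∈ e.source then
    (u (e x)).compContinuousLinearMap
      (mfderiv (𝓡 n) (𝓡 n) e x : TangentSpace (𝓡 n) x →L[ℝ] Euc n) else 0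

theorem formOf_of_mem {u : Euc n → Alt n m} {x : M} (hx : x ∈ e.source) :
    formOf e u x = (u (e x)).compContinuousLinearMap
      (mfderiv (𝓡 n) (𝓡 n) e x : TangentSpace (𝓡 n) x →L[ℝ] Euc n) := if_pos hx

theorem formOf_of_notMem {u : Euc n → Alt n m} {x : M} (hx : x ∉ e.source) :
    formOf e u x = 0 := if_neg hx

theorem formOf_add (e : OpenPartialHomeomorph M (Euc n)) (u v : Euc n → Alt n m) :
    formOf e (u + v) = formOf e u + formOf e v := by
  funext x
  by_cases h : x ∈ e.source
  · simp only [Pi.add_apply, formOf_of_mem h]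
    rfl
  · simp only [Pi.add_apply, formOf_of_notMem h, add_zero]

theorem formOf_smul (e : OpenPartialHomeomorph M (Euc n)) (c : ℝ) (u : Euc n → Alt n m) :
    formOf e (c • u) = c • formOf e u := by
  funext x
  by_cases h : x ∈ e.source
  · simp only [Pi.smul_apply, formOf_of_mem h]
    rfl
  · simp only [Pi.smul_apply, formOf_of_notMem h, smul_zero]

theorem formOf_eq_zero (u : 𝓓_{L}(Euc n, Alt n m)) {x : M} (hx : x ∉ e.symm '' L) :
    formOf e u x = 0 := by
  by_cases h : x ∈ e.source
  · rw [formOf_of_mem h, u.zero_on_compl fun h' => hx ⟨e x, h', e.left_inv h⟩]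
    ext v
    rfl
  · exact formOf_of_notMem h

theorem chartRep_pullbackField {f : M → M} (hf : ContMDiff (𝓡 n) (𝓡 n) ∞ f)
    (he : e ∈ IsManifold.maximalAtlas (𝓡 n) ∞ M) (he' : e' ∈ IsManifold.maximalAtlas (𝓡 n) ∞ M)
    (α : FormField n M m) {y : Euc n} (hy : y ∈ e.target) (hy' : f (e.symm y) ∈ e'.source) :
    chartRep e (pullbackField f α) y =
      (chartRep e' α (e' (f (e.symm y)))).compContinuousLinearMap
        (fderiv ℝ (fun y => e' (f (e.symm y))) y) := by
  have hne : (∞ : ℕ∞ω) ≠ 0 := by simp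
  have hes := contMDiffAt_symm_of_mem he hy
  have hfe : ContMDiffAt (𝓡 n) (𝓡 n) ∞ (fun y => f (e.symm y)) y := hf.contMDiffAt.comp y hes
  have hg : ContMDiffAt (𝓡 n) (𝓡 n) ∞ (fun y => e' (f (e.symm y))) y :=
    (contMDiffAt_of_mem he' hy').comp y hfe
  have hpt : e'.symm (e' (f (e.symm y))) = f (e.symm y) := e'.left_inv hy'
  have hchain : mfderiv (𝓡 n) (𝓡 n) (fun y => f (e.symm y)) y =
      (mfderiv (𝓡 n) (𝓡 n) f (e.symm y)).comp (mfderiv (𝓡 n) (𝓡 n) e.symm y) :=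
    mfderiv_comp y (hf.contMDiffAt.mdifferentiableAt hne) (hes.mdifferentiableAt hne)
  have hchain' : mfderiv (𝓡 n) (𝓡 n) (fun y => e'.symm (e' (f (e.symm y)))) y =
      (mfderiv (𝓡 n) (𝓡 n) e'.symm (e' (f (e.symm y)))).comp
        (mfderiv (𝓡 n) (𝓡 n) (fun y => e' (f (e.symm y))) y) :=
    mfderiv_comp y ((contMDiffAt_symm_of_mem he' (e'.map_source hy')).mdifferentiableAt hne)
      (hg.mdifferentiableAt hne)
  have hinv : (fun y => e'.symm (e' (f (e.symm y)))) =ᶠ[𝓝 y] fun y => f (e.symm y) := by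
    filter_upwards [hfe.continuousAt.preimage_mem_nhds (e'.open_source.mem_nhds hy')] with z hz
    exact e'.left_inv hz
  ext v
  refine apply_congr_point α hpt.symm (funext fun i => ?_)
  have hderiv := (hchain.symm.trans (hinv.mfderiv_eq (I := 𝓡 n) (I' := 𝓡 n)).symm).trans hchain'
  rw [mfderiv_eq_fderiv] at hderiv
  exact DFunLike.congr_fun hderiv (v i)

theorem chartRep_eq_of_mem (he : e ∈ IsManifold.maximalAtlas (𝓡 n) ∞ M)
    (he' : e' ∈ IsManifold.maximalAtlas (𝓡 n) ∞ M)
    (α : FormField n M m) {y : Euc n} (hy : y ∈ e.target) (hy' : e.symm y ∈ e'.source) :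
    chartRep e α y = (chartRep e' α (e' (e.symm y))).compContinuousLinearMap
        (fderiv ℝ (fun y => e' (e.symm y)) y) := by
  have h := chartRep_pullbackField contMDiff_id he he' α hy hy'
  rw [pullbackField_id] at h
  exact h

theorem contDiffOn_transition (he : e ∈ IsManifold.maximalAtlas (𝓡 n) ∞ M)
    (he' : e' ∈ IsManifold.maximalAtlas (𝓡 n) ∞ M) :
    ContDiffOn ℝ ∞ (fun y => e' (e.symm y)) (e.target ∩ e.symm ⁻¹' e'.source) := fun y hy =>
  ((contMDiffAt_of_mem he' hy.2).comp y
    (contMDiffAt_symm_of_mem he hy.1)).contDiffAt.contDiffWithinAt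

theorem chartRep_formOf (he : e ∈ IsManifold.maximalAtlas (𝓡 n) ∞ M) (u : Euc n → Alt n m)
    {y : Euc n} (hy : y ∈ e.target) : chartRep e (formOf e u) y = u y := by
  have hne : (∞ : ℕ∞ω) ≠ 0 := by simp
  have hx : e.symm y ∈ e.source := e.map_target hy
  have hchain : mfderiv (𝓡 n) (𝓡 n) (fun y => e (e.symm y)) y =
      (mfderiv (𝓡 n) (𝓡 n) e (e.symm y)).comp (mfderiv (𝓡 n) (𝓡 n) e.symm y) :=
    mfderiv_comp y ((contMDiffAt_of_mem he hx).mdifferentiableAt hne)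
      ((contMDiffAt_symm_of_mem he hy).mdifferentiableAt hne)
  have hinv : (fun y => e (e.symm y)) =ᶠ[𝓝 y] id := by
    filter_upwards [e.open_target.mem_nhds hy] with z hz using e.right_inv hz
  have hderiv := hchain.symm.trans (hinv.mfderiv_eq (I := 𝓡 n) (I' := 𝓡 n))
  rw [mfderiv_id] at hderiv
  rw [chartRep, formOf_of_mem hx]
  ext v
  change u (e (e.symm y)) _ = u y v
  rw [e.right_inv hy]
  congr 1
  funext i
  exact DFunLike.congr_fun hderiv (v i)

theorem formOf_chartRep (he : e ∈ IsManifold.maximalAtlas (𝓡 n) ∞ M) (ρ : Euc n → ℝ)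
    (β : FormField n M m) {x : M} (hx : x ∈ e.source) :
    formOf e (fun y => ρ y • chartRep e β y) x = ρ (e x) • β x := by
  have hne : (∞ : ℕ∞ω) ≠ 0 := by simp
  have hchain : mfderiv (𝓡 n) (𝓡 n) (fun x => e.symm (e x)) x =
      (mfderiv (𝓡 n) (𝓡 n) e.symm (e x)).comp (mfderiv (𝓡 n) (𝓡 n) e x) :=
    mfderiv_comp x ((contMDiffAt_symm_of_mem he (e.map_source hx)).mdifferentiableAt hne)
      ((contMDiffAt_of_mem he hx).mdifferentiableAt hne)
  have hinv : (fun x => e.symm (e x)) =ᶠ[𝓝 x] id := by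
    filter_upwards [e.open_source.mem_nhds hx] with z hz using e.left_inv hz
  have hderiv := hchain.symm.trans (hinv.mfderiv_eq (I := 𝓡 n) (I' := 𝓡 n))
  rw [mfderiv_id] at hderiv
  rw [formOf_of_mem hx]
  ext v
  refine congrArg (ρ (e x) * ·) (apply_congr_point β (e.left_inv hx) (funext fun i => ?_))
  exact DFunLike.congr_fun hderiv (v i)

variable [T2Space M]

theorem formSupport_formOf_subset (hLe : ↑L ⊆ e.target) (u : 𝓓_{L}(Euc n, Alt n m)) :
    formSupport (formOf e u) ⊆ e.symm '' L :=
  closure_minimal (fun _ hx => by_contra fun h => hx (formOf_eq_zero u h))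
    (isCompact_symm_image hLe).isClosed

theorem isSmoothForm_formOf (he : e ∈ IsManifold.maximalAtlas (𝓡 n) ∞ M)
    (hLe : ↑L ⊆ e.target) (u : 𝓓_{L}(Euc n, Alt n m)) : IsSmoothForm (formOf e u) := by
  intro e' he' y hy
  refine ContDiffAt.contDiffWithinAt ?_
  by_cases h : e'.symm y ∈ e.source
  · have hO := isOpen_overlap e' e
    have hθ := contDiffOn_transition he' he
    have hsmooth := ((contDiff_compContinuousLinearMap n m).comp_contDiffOn
      ((u.contDiff.comp_contDiffOn hθ).prodMk
        (hθ.fderiv_of_isOpen hO (by simp)))).contDiffAt (hO.mem_nhds ⟨hy, h⟩)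
    refine hsmooth.congr_of_eventuallyEq ?_
    filter_upwards [hO.mem_nhds ⟨hy, h⟩] with z hz
    rw [chartRep_eq_of_mem he' he _ hz.1 hz.2, chartRep_formOf he _ (e.map_source hz.2)]
    rfl
  · refine (contDiffAt_const (c := 0)).congr_of_eventuallyEq ?_
    have hyL : e'.symm y ∉ e.symm '' L := by
      rintro ⟨z, hz, hzy⟩
      exact h (hzy ▸ e.map_target (hLe hz))
    filter_upwards [eventually_symm_notMem_image hLe hy hyL] with z hz
    exact chartRep_eq_zero (formOf_eq_zero u hz)

/-- The transport of test functions supported in a compact subset `L` of a chart to test forms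
on `M`. -/
def testFormOf (he : e ∈ IsManifold.maximalAtlas (𝓡 n) ∞ M) (hLe : ↑L ⊆ e.target) :
    𝓓_{L}(Euc n, Alt n m) →ₗ[ℝ] testForms n M m where
  toFun u := ⟨formOf e u, isSmoothForm_formOf he hLe u,
    (isCompact_symm_image hLe).of_isClosed_subset isClosed_closure
      (formSupport_formOf_subset hLe u)⟩
  map_add' u v := Subtype.ext (formOf_add e u v)
  map_smul' c u := Subtype.ext (formOf_smul e c u)

end Charts

/-! ### Smooth families of maps in charts -/

section Families

variable {n m : ℕ} {M : Type*} [TopologicalSpace M]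
  {V B : Type*} [NormedAddCommGroup V] [NormedSpace ℝ V] [TopologicalSpace B]
  {I : ModelWithCorners ℝ V B} {P : Type*} [TopologicalSpace P]
  {f : P → M → M} {e e' : OpenPartialHomeomorph M (Euc n)}

/-- The expression of the family of maps `f` in the charts `e` and `e'`, meaningful on
`familyDomain f e e'`. -/
def familyRep (f : P → M → M) (e e' : OpenPartialHomeomorph M (Euc n)) (p : P) (y : Euc n) :
    Euc n := e' (f p (e.symm y))

/-- The pairs `(p, y)` such that `f p` maps the point with coordinates `y` in the chart `e` into
the domain of the chart `e'`. -/
def familyDomain (f : P → M → M) (e e' : OpenPartialHomeomorph M (Euc n)) : Set (P × Euc n) :=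
  {q | q.2 ∈ e.target ∧ f q.1 (e.symm q.2) ∈ e'.source}

theorem isOpen_familyDomain (hf : Continuous (Function.uncurry f)) :
    IsOpen (familyDomain f e e') := by
  have h : ContinuousOn (fun q : P × Euc n => f q.1 (e.symm q.2)) (univ ×ˢ e.target) :=
    hf.comp_continuousOn (continuousOn_fst.prodMk
      (e.continuousOn_symm.comp continuousOn_snd fun q hq => hq.2))
  convert h.isOpen_inter_preimage (isOpen_univ.prod e.open_target) e'.open_source using 1
  ext q
  simp [familyDomain]

variable [ChartedSpace (Euc n) M] [ChartedSpace B P]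

theorem contMDiffOn_familyRep (hf : ContMDiff (I.prod (𝓡 n)) (𝓡 n) ∞ (Function.uncurry f))
    (he : e ∈ IsManifold.maximalAtlas (𝓡 n) ∞ M) (he' : e' ∈ IsManifold.maximalAtlas (𝓡 n) ∞ M) :
    ContMDiffOn (I.prod (𝓡 n)) (𝓡 n) ∞ (Function.uncurry (familyRep f e e'))
      (familyDomain f e e') := fun q hq =>
  ((contMDiffAt_of_mem he' hq.2).comp q (hf.contMDiffAt.comp q (contMDiffAt_fst.prodMk
    ((contMDiffAt_symm_of_mem he hq.1).comp q contMDiffAt_snd)))).contMDiffWithinAt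

theorem contMDiffAt_familyRep (hf : ContMDiff (I.prod (𝓡 n)) (𝓡 n) ∞ (Function.uncurry f))
    (he : e ∈ IsManifold.maximalAtlas (𝓡 n) ∞ M) (he' : e' ∈ IsManifold.maximalAtlas (𝓡 n) ∞ M)
    {q : P × Euc n} (hq : q ∈ familyDomain f e e') :
    ContMDiffAt (I.prod (𝓡 n)) (𝓡 n) ∞ (Function.uncurry (familyRep f e e')) q :=
  (contMDiffOn_familyRep hf he he').contMDiffAt ((isOpen_familyDomain hf.continuous).mem_nhds hq)

theorem chartRep_pullbackField_family
    (hf : ContMDiff (I.prod (𝓡 n)) (𝓡 n) ∞ (Function.uncurry f))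
    (he : e ∈ IsManifold.maximalAtlas (𝓡 n) ∞ M) (he' : e' ∈ IsManifold.maximalAtlas (𝓡 n) ∞ M)
    (α : FormField n M m) {q : P × Euc n} (hq : q ∈ familyDomain f e e') :
    chartRep e (pullbackField (f q.1) α) q.2 =
      (chartRep e' α (familyRep f e e' q.1 q.2)).compContinuousLinearMap
        (fderiv ℝ (familyRep f e e' q.1) q.2) :=
  chartRep_pullbackField (hf.comp (contMDiff_const.prodMk contMDiff_id)) he he' α hq.1 hq.2

variable [IsManifold I ∞ P]

theorem contMDiffAt_fderiv_familyRep
    (hf : ContMDiff (I.prod (𝓡 n)) (𝓡 n) ∞ (Function.uncurry f))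
    (he : e ∈ IsManifold.maximalAtlas (𝓡 n) ∞ M) (he' : e' ∈ IsManifold.maximalAtlas (𝓡 n) ∞ M)
    {q : P × Euc n} (hq : q ∈ familyDomain f e e') :
    ContMDiffAt (I.prod (𝓡 n)) 𝓘(ℝ, Euc n →L[ℝ] Euc n) ∞
      (fun q : P × Euc n => fderiv ℝ (familyRep f e e' q.1) q.2) q :=
  contMDiffAt_fderiv_right (contMDiffAt_familyRep hf he he' hq)

theorem contMDiffOn_chartRep_pullbackField [IsManifold (𝓡 n) ∞ M]
    (hf : ContMDiff (I.prod (𝓡 n)) (𝓡 n) ∞ (Function.uncurry f))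
    (he : e ∈ IsManifold.maximalAtlas (𝓡 n) ∞ M) {α : FormField n M m} (hα : IsSmoothForm α) :
    ContMDiffOn (I.prod (𝓡 n)) 𝓘(ℝ, Alt n m) ∞
      (Function.uncurry fun p y => chartRep e (pullbackField (f p) α) y) (univ ×ˢ e.target) := by
  intro q hq
  have he' : chartAt (Euc n) (f q.1 (e.symm q.2)) ∈ IsManifold.maximalAtlas (𝓡 n) ∞ M :=
    IsManifold.chart_mem_maximalAtlas _
  have hqd : q ∈ familyDomain f e (chartAt (Euc n) (f q.1 (e.symm q.2))) :=
    ⟨hq.2, mem_chart_source _ _⟩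
  set e' := chartAt (Euc n) (f q.1 (e.symm q.2))
  have hrep : ContMDiffAt (I.prod (𝓡 n)) 𝓘(ℝ, Alt n m) ∞
      (fun q : P × Euc n => chartRep e' α (familyRep f e e' q.1 q.2)) q :=
    (((hα e' he').contDiffAt (e'.open_target.mem_nhds (e'.map_source hqd.2))).contMDiffAt).comp q
      (contMDiffAt_familyRep hf he he' hqd)
  have hcomp := (contDiff_compContinuousLinearMap n m).contMDiff.contMDiffAt.comp q
    (hrep.prodMk_space (contMDiffAt_fderiv_familyRep hf he he' hqd))
  refine (hcomp.congr_of_eventuallyEq ?_).contMDiffWithinAt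
  filter_upwards [(isOpen_familyDomain hf.continuous).mem_nhds hqd] with p hp
  exact chartRep_pullbackField_family hf he he' α hp

theorem jetsTendstoZero_chartRep_pullbackField {κ : Type*} {l : Filter κ} {π : κ → P} {p₀ : P}
    (hf : ContMDiff (I.prod (𝓡 n)) (𝓡 n) ∞ (Function.uncurry f)) (hπ : Tendsto π l (𝓝 p₀))
    (he : e ∈ IsManifold.maximalAtlas (𝓡 n) ∞ M) (he' : e' ∈ IsManifold.maximalAtlas (𝓡 n) ∞ M)
    {y₀ : Euc n} (h₀ : (p₀, y₀) ∈ familyDomain f e e') {α : κ → FormField n M m}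
    (hα : JetsTendstoZero l (fun k => chartRep e' (α k)) (familyRep f e e' p₀ y₀)) :
    JetsTendstoZero l (fun k => chartRep e (pullbackField (f (π k)) (α k))) y₀ := by
  have hO := isOpen_familyDomain (e := e) (e' := e') hf.continuous
  have hA : ContMDiffOn (I.prod (𝓡 n)) 𝓘(ℝ, Alt n m →L[ℝ] Alt n m) ∞
      (Function.uncurry fun p y => (ContinuousAlternatingMap.compContinuousLinearMapCLM
        (fderiv ℝ (familyRep f e e' p) y) : Alt n m →L[ℝ] Alt n m)) (familyDomain f e e') :=
    fun q hq => ((contDiff_compContinuousLinearMapCLM n m).contMDiff.contMDiffAt.comp q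
      (contMDiffAt_fderiv_familyRep hf he he' hq)).contMDiffWithinAt
  refine (hα.substitution hπ hO h₀ hA (contMDiffOn_familyRep hf he he')).congr ?_
  have hw : Tendsto (fun w : κ × Euc n => (π w.1, w.2)) (l ×ˢ 𝓝 y₀) (𝓝 (p₀, y₀)) := by
    rw [nhds_prod_eq]
    exact hπ.prodMap tendsto_id
  filter_upwards [hw.eventually (hO.mem_nhds h₀)] with w hwO
  exact (chartRep_pullbackField_family hf he he' (α w.1) (q := (π w.1, w.2)) hwO).symm

theorem jetsTendstoZero_chartRep_of_chart {κ : Type*} {l : Filter κ}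
    (he : e ∈ IsManifold.maximalAtlas (𝓡 n) ∞ M) (he' : e' ∈ IsManifold.maximalAtlas (𝓡 n) ∞ M)
    {y₀ : Euc n} (hy₀ : y₀ ∈ e.target) (hy₀' : e.symm y₀ ∈ e'.source) {α : κ → FormField n M m}
    (hα : JetsTendstoZero l (fun k => chartRep e' (α k)) (e' (e.symm y₀))) :
    JetsTendstoZero l (fun k => chartRep e (α k)) y₀ := by
  have h := jetsTendstoZero_chartRep_pullbackField (I := 𝓘(ℝ, ℝ)) (f := fun _ : ℝ => id)
    contMDiff_snd (tendsto_const_nhds (x := 0)) he he' ⟨hy₀, hy₀'⟩ hα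
  simpa only [pullbackField_id] using h

end Families

/-! ### Convergence of test forms -/

section FormsTendstoZero

variable {n m : ℕ} {M : Type*} [TopologicalSpace M] [ChartedSpace (Euc n) M]
  {κ : Type*} {l : Filter κ} {α : κ → testForms n M m}

/-- The version of `TendstoZero` for families of test forms indexed by a filter. -/
structure FormsTendstoZero (l : Filter κ) (α : κ → testForms n M m) : Prop where
  exists_isCompact : ∃ K, IsCompact K ∧ ∀ k, formSupport (α k : FormField n M m) ⊆ K
  jetsTendstoZero : ∀ e ∈ IsManifold.maximalAtlas (𝓡 n) ∞ M, ∀ y ∈ e.target,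
    JetsTendstoZero l (fun k => chartRep e (α k : FormField n M m)) y

theorem contDiffAt_chartRep {e : OpenPartialHomeomorph M (Euc n)}
    (he : e ∈ IsManifold.maximalAtlas (𝓡 n) ∞ M) (α : testForms n M m) {y : Euc n}
    (hy : y ∈ e.target) : ContDiffAt ℝ ∞ (chartRep e (α : FormField n M m)) y :=
  (α.2.1 e he).contDiffAt (e.open_target.mem_nhds hy)

theorem tendstoUniformlyOn_zero_compacts_iff {X Y : Type*} [TopologicalSpace X]
    [LocallyCompactSpace X] [NormedAddCommGroup Y] {U : Set X} (hU : IsOpen U) {F : κ → X → Y} :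
    (∀ L ⊆ U, IsCompact L → TendstoUniformlyOn F 0 l L) ↔
      ∀ x ∈ U, Tendsto (fun w : κ × X => F w.1 w.2) (l ×ˢ 𝓝 x) (𝓝 0) := by
  rw [← tendstoLocallyUniformlyOn_iff_forall_isCompact hU,
    tendstoLocallyUniformlyOn_iff_forall_tendsto]
  refine forall₂_congr fun x hx => ?_
  rw [hU.nhdsWithin_eq hx, uniformity_eq_comap_nhds_zero, tendsto_comap_iff]
  simp only [Function.comp_def, Pi.zero_apply, sub_zero]

theorem formsTendstoZero_atTop_iff {α : ℕ → testForms n M m} :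
    FormsTendstoZero atTop α ↔ TendstoZero α := by
  refine ⟨fun h => ⟨h.exists_isCompact, fun e he L hLe hL r => ?_⟩, fun h => ⟨h.1, fun e he y hy =>
    ⟨?_, fun r => (tendstoUniformlyOn_zero_compacts_iff e.open_target).1
      (fun L hLe hL => h.2 e he L hLe hL r) y hy⟩⟩⟩
  · exact (tendstoUniformlyOn_zero_compacts_iff e.open_target).2
      (fun y hy => (h.jetsTendstoZero e he y hy).tendsto_iteratedFDeriv r) L hLe hL
  · filter_upwards [tendsto_snd.eventually (e.open_target.mem_nhds hy)] with w hw
    exact contDiffAt_chartRep he (α w.1) hw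

namespace FormsTendstoZero

theorem comp_tendsto {κ' : Type*} {l' : Filter κ'} {φ : κ' → κ} (h : FormsTendstoZero l α)
    (hφ : Tendsto φ l' l) : FormsTendstoZero l' (fun k => α (φ k)) where
  exists_isCompact := h.exists_isCompact.imp fun _ hK => ⟨hK.1, fun _ => hK.2 _⟩
  jetsTendstoZero e he y hy := (h.jetsTendstoZero e he y hy).comp_tendsto hφ

theorem tendsto_current [l.IsCountablyGenerated] (h : FormsTendstoZero l α) (T : currents n m M) :
    Tendsto (fun k => T.1 (α k)) l (𝓝 0) :=
  tendsto_of_seq_tendsto fun _ hx => T.2 _ (formsTendstoZero_atTop_iff.1 (h.comp_tendsto hx))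

theorem of_charts
    (hsupp : ∃ K, IsCompact K ∧ ∀ k, formSupport (α k : FormField n M m) ⊆ K)
    (h : ∀ x : M, ∃ e ∈ IsManifold.maximalAtlas (𝓡 n) ∞ M, x ∈ e.source ∧
      JetsTendstoZero l (fun k => chartRep e (α k : FormField n M m)) (e x)) :
    FormsTendstoZero l α where
  exists_isCompact := hsupp
  jetsTendstoZero e he y hy := by
    obtain ⟨e', he', hx, hjets⟩ := h (e.symm y)
    exact jetsTendstoZero_chartRep_of_chart he he' hy hx hjets

end FormsTendstoZero

end FormsTendstoZero

/-! ### Mollification -/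

section Mollification

universe u

theorem integral_compacts_eq_integral {X F : Type*} [TopologicalSpace X] [T2Space X]
    [MeasurableSpace X] [BorelSpace X] [NormedAddCommGroup F] [NormedSpace ℝ F] (μ : Measure X)
    (K : Compacts X) {g : X → F} (hg : ∀ x ∉ K, g x = 0) :
    ∫ x : K, g x ∂(μ.comap Subtype.val) = ∫ x, g x ∂μ :=
  (integral_subtype_comap K.isCompact.measurableSet g).trans
    (setIntegral_eq_integral_of_forall_compl_eq_zero hg)

theorem isFiniteMeasure_comap_compacts {X : Type*} [TopologicalSpace X] [T2Space X]
    [MeasurableSpace X] [BorelSpace X] (μ : Measure X) [IsFiniteMeasureOnCompacts μ]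
    (K : Compacts X) : IsFiniteMeasure (μ.comap (Subtype.val : K → X)) where
  measure_univ_lt_top := by
    have h := (MeasurableEmbedding.subtype_coe K.isCompact.measurableSet).comap_apply μ univ
    exact h.trans_lt ((measure_mono (by simp)).trans_lt K.isCompact.measure_lt_top)

variable {E F : Type u} [NormedAddCommGroup E] [NormedSpace ℝ E] [FiniteDimensional ℝ E]
  [MeasurableSpace E] [BorelSpace E] [NormedAddCommGroup F] [NormedSpace ℝ F]
  (μ : Measure E) [μ.IsAddHaarMeasure] {K L : Compacts E} {φ : ContDiffBump (0 : E)}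

open ContinuousLinearMap (lsmul)
open Metric (cthickening)

theorem iteratedFDeriv_normed_convolution (φ : ContDiffBump (0 : E)) {v : E → F}
    (hv : ContDiff ℝ ∞ v) (j : ℕ) (x : E) :
    iteratedFDeriv ℝ j (convolution (φ.normed μ) v (lsmul ℝ ℝ) μ) x =
      convolution (φ.normed μ) (iteratedFDeriv ℝ j v) (lsmul ℝ ℝ) μ x := by
  let X : Compacts E := ⟨tsupport (φ.normed μ), φ.hasCompactSupport_normed⟩
  have hX {Y : Type u} [NormedAddCommGroup Y] [NormedSpace ℝ Y] (w : E → Y) (x : E) :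
      convolution (φ.normed μ) w (lsmul ℝ ℝ) μ x =
        ∫ z : X, φ.normed μ z • w (x - z) ∂(μ.comap Subtype.val) :=
    (integral_compacts_eq_integral μ X fun z hz => by
      simp only [image_eq_zero_of_notMem_tsupport hz, map_zero, zero_apply]).symm
  have hH : ContDiff ℝ ∞ (Function.uncurry fun z y => φ.normed μ z • v (y - z)) :=
    (φ.contDiff_normed.comp contDiff_fst).smul (hv.comp (contDiff_snd.sub contDiff_fst))
  have hH' : ContMDiffOn (𝓘(ℝ, E).prod 𝓘(ℝ, E)) 𝓘(ℝ, F) ∞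
      (Function.uncurry fun z y => φ.normed μ z • v (y - z)) (univ ×ˢ univ) := by
    have h := hH.contMDiff.contMDiffOn (s := univ ×ˢ univ)
    rwa [modelWithCornersSelf_prod, ← chartedSpaceSelf_prod] at h
  have := isFiniteMeasure_comap_compacts μ X
  rw [hX, funext (hX v)]
  refine (iteratedFDeriv_integral_of_compactSpace ⟨Subtype.val, continuous_subtype_val⟩
    (μ.comap (Subtype.val : X → E)) isOpen_univ hH' j (mem_univ x)).trans ?_
  refine integral_congr_ae (.of_forall fun z => ?_)
  refine (iteratedFDeriv_const_smul_apply' (f := fun y => v (y - z)) ?_).trans ?_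
  · exact ((hv.comp (contDiff_id.sub contDiff_const)).of_le (natCast_le_infty j)).contDiffAt
  · exact congrArg (φ.normed μ z • ·) (iteratedFDeriv_comp_sub j (z : E) x)

theorem norm_normed_convolution_le [CompleteSpace F] (φ : ContDiffBump (0 : E)) {v : E → F}
    (hv : Continuous v) {C : ℝ} (hC : ∀ x, ‖v x‖ ≤ C) (x : E) :
    ‖convolution (φ.normed μ) v (lsmul ℝ ℝ) μ x‖ ≤ C := by
  rw [← dist_zero_right]
  exact dist_convolution_le ((norm_nonneg _).trans (hC 0)) φ.support_normed_eq.subset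
    φ.nonneg_normed φ.integral_normed hv.aestronglyMeasurable fun y _ => by
      rw [dist_zero_right]
      exact hC y

theorem normed_sub_eq_zero (hφ : cthickening φ.rOut (K : Set E) ⊆ (L : Set E)) {x z : E}
    (hz : z ∈ K) (hx : x ∉ L) : φ.normed μ (x - z) = 0 := by
  by_contra h
  have hxz : x - z ∈ Metric.ball 0 φ.rOut := φ.support_normed_eq (μ := μ) ▸ h
  refine hx (hφ (Metric.mem_cthickening_of_dist_le x z φ.rOut K hz ?_))
  rw [dist_eq_norm]
  exact (mem_ball_zero_iff.1 hxz).le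

/-- The function `φ (· - z) v(z)`, the contribution of the point `z` to the convolution
`φ ⋆ v`. -/
def mollifierKernel (hφ : cthickening φ.rOut (K : Set E) ⊆ (L : Set E)) (v : 𝓓_{K}(E, F))
    (z : E) : 𝓓_{L}(E, F) :=
  .of_support_subset (f := fun x => φ.normed μ (x - z) • v z)
    ((φ.contDiff_normed.comp (contDiff_id.sub contDiff_const)).smul contDiff_const)
    fun x hx => by_contra fun hxL => hx <| by
      by_cases hz : z ∈ K
      · simp only [normed_sub_eq_zero μ hφ hz hxL, zero_smul]
      · simp only [v.zero_on_compl hz, Pi.zero_apply, smul_zero]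

theorem contDiff_mollifierKernel (hφ : cthickening φ.rOut (K : Set E) ⊆ (L : Set E))
    (v : 𝓓_{K}(E, F)) :
    ContDiff ℝ ∞ fun q : E × E => mollifierKernel μ hφ v q.1 q.2 :=
  (φ.contDiff_normed.comp (contDiff_snd.sub contDiff_fst)).smul (v.contDiff.comp contDiff_fst)

theorem convolutionExists_normed (φ : ContDiffBump (0 : E)) (v : 𝓓_{K}(E, F)) :
    ConvolutionExists (φ.normed μ) v (lsmul ℝ ℝ) μ :=
  φ.hasCompactSupport_normed.convolutionExists_left_of_continuous_right _
    φ.integrable_normed.locallyIntegrable v.continuous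

variable [CompleteSpace F]

/-- The convolution `v ↦ φ ⋆ v` with the normalised bump function `φ`. -/
def mollify (hφ : cthickening φ.rOut (K : Set E) ⊆ (L : Set E)) :
    𝓓_{K}(E, F) →L[ℝ] 𝓓_{L}(E, F) :=
  ContDiffMapSupportedIn.mkCLM ℝ (fun v => convolution (φ.normed μ) v (lsmul ℝ ℝ) μ)
    (fun v w => congrFun <|
      (convolutionExists_normed μ φ v).distrib_add (convolutionExists_normed μ φ w))
    (fun _ _ => congrFun convolution_smul)
    (fun v => v.hasCompactSupport.contDiff_convolution_right _
      φ.integrable_normed.locallyIntegrable v.contDiff)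
    (fun v x hx => convolution_lsmul_swap.trans <| integral_eq_zero_of_ae <|
      .of_forall fun z => (mollifierKernel μ hφ v z).zero_on_compl hx)
    fun j _ => ⟨{j}, 1, zero_le_one, fun v x _ => by
      rw [iteratedFDeriv_normed_convolution μ φ v.contDiff, Finset.sup_singleton, one_mul]
      exact norm_normed_convolution_le μ φ
        (v.contDiff.continuous_iteratedFDeriv (by exact_mod_cast le_top))
        (fun y => ContDiffMapSupportedIn.norm_iteratedFDeriv_apply_le_seminorm_top ℝ) x⟩

theorem mollify_apply (hφ : cthickening φ.rOut (K : Set E) ⊆ (L : Set E)) (v : 𝓓_{K}(E, F))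
    (x : E) : mollify μ hφ v x = ∫ z, mollifierKernel μ hφ v z x ∂μ :=
  convolution_lsmul_swap

theorem tendsto_iteratedFDeriv_mollify {κ : Type*} {l : Filter κ} {φ : κ → ContDiffBump (0 : E)}
    (hφ : ∀ k, cthickening (φ k).rOut (K : Set E) ⊆ (L : Set E))
    (hl : Tendsto (fun k => (φ k).rOut) l (𝓝 0))
    {u : κ → 𝓓_{K}(E, F)} {u₀ : 𝓓_{K}(E, F)} (hu : Tendsto u l (𝓝 u₀)) (j : ℕ) (y : E) :
    Tendsto (fun w : κ × E => iteratedFDeriv ℝ j (mollify μ (hφ w.1) (u w.1)) w.2) (l ×ˢ 𝓝 y)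
      (𝓝 (iteratedFDeriv ℝ j u₀ y)) := by
  have hj (v : 𝓓_{K}(E, F)) : Continuous (iteratedFDeriv ℝ j v) :=
    v.contDiff.continuous_iteratedFDeriv (by exact_mod_cast le_top)
  have hu' : Tendsto (fun w : κ × E => iteratedFDeriv ℝ j (u w.1) w.2) (l ×ˢ 𝓝 y)
      (𝓝 (iteratedFDeriv ℝ j u₀ y)) := by
    have h := ((tendsto_zero_iff_jetsTendstoZero.1 (tendsto_sub_nhds_zero_iff.2 hu) y).2 j).add
      (((hj u₀).tendsto y).comp (tendsto_snd (f := l)))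
    rw [zero_add] at h
    refine h.congr fun w => ?_
    have hsub := iteratedFDeriv_sub_apply (i := j) (x := w.2)
      ((u w.1).contDiff.contDiffAt.of_le (natCast_le_infty j))
      (u₀.contDiff.contDiffAt.of_le (natCast_le_infty j))
    exact (congrArg (· + _) hsub).trans (sub_add_cancel _ _)
  have hconv := ContDiffBump.convolution_tendsto_right (μ := μ) (k := fun w : κ × E => w.2)
    (g := fun w : κ × E => iteratedFDeriv ℝ j (u w.1)) (hl.comp tendsto_fst)
    (.of_forall fun _ => (hj _).aestronglyMeasurable)
    (hu'.comp ((tendsto_fst.comp tendsto_fst).prodMk tendsto_snd)) tendsto_snd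
  exact hconv.congr fun w =>
    (iteratedFDeriv_normed_convolution μ (φ w.1) (u w.1).contDiff j w.2).symm

theorem tendsto_mollify {κ : Type*} {l : Filter κ} {φ : κ → ContDiffBump (0 : E)} (hKL : K ≤ L)
    (hφ : ∀ k, cthickening (φ k).rOut (K : Set E) ⊆ (L : Set E))
    (hl : Tendsto (fun k => (φ k).rOut) l (𝓝 0))
    {u : κ → 𝓓_{K}(E, F)} {u₀ : 𝓓_{K}(E, F)} (hu : Tendsto u l (𝓝 u₀)) :
    Tendsto (fun k => mollify μ (hφ k) (u k)) l
      (𝓝 (ContDiffMapSupportedIn.monoCLM ℝ u₀)) := by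
  rw [← tendsto_sub_nhds_zero_iff, tendsto_zero_iff_jetsTendstoZero]
  have hmono : ⇑(ContDiffMapSupportedIn.monoCLM ℝ u₀ : 𝓓_{L}(E, F)) = u₀ := by
    rw [ContDiffMapSupportedIn.monoCLM_apply, if_pos ⟨le_rfl, hKL⟩]
  refine fun y => ⟨.of_forall fun w => ContDiffMapSupportedIn.contDiff _ |>.contDiffAt, fun j => ?_⟩
  have h₀ : Tendsto (fun w : κ × E => iteratedFDeriv ℝ j u₀ w.2) (l ×ˢ 𝓝 y)
      (𝓝 (iteratedFDeriv ℝ j u₀ y)) :=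
    ((u₀.contDiff.continuous_iteratedFDeriv (by exact_mod_cast le_top)).tendsto y).comp
      tendsto_snd
  have h := (tendsto_iteratedFDeriv_mollify μ hφ hl hu j y).sub h₀
  rw [sub_self] at h
  refine h.congr fun w => ?_
  rw [← hmono]
  exact (iteratedFDeriv_sub_apply
    ((mollify μ (hφ w.1) (u w.1)).contDiff.contDiffAt.of_le (natCast_le_infty j))
    ((ContDiffMapSupportedIn.contDiff _).contDiffAt.of_le (natCast_le_infty j))).symm

theorem clm_mollify (T : 𝓓_{L}(E, F) →L[ℝ] ℝ)
    (hφ : cthickening φ.rOut (K : Set E) ⊆ (L : Set E)) (v : 𝓓_{K}(E, F)) :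
    T (mollify μ hφ v) = ∫ z, T (mollifierKernel μ hφ v z) ∂μ := by
  have := isFiniteMeasure_comap_compacts μ K
  have hker (z : E) (hz : z ∉ K) : mollifierKernel μ hφ v z = 0 := by
    ext x
    exact (congrArg (φ.normed μ (x - z) • ·) (v.zero_on_compl hz)).trans (smul_zero _)
  have hsmooth : ContMDiff (𝓘(ℝ, E).prod 𝓘(ℝ, E)) 𝓘(ℝ, F) ∞
      fun q : E × E => mollifierKernel μ hφ v q.1 q.2 := by
    have h := (contDiff_mollifierKernel μ hφ v).contMDiff
    rwa [modelWithCornersSelf_prod, ← chartedSpaceSelf_prod] at h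
  have h := clm_integral_of_compactSpace (μ.comap (Subtype.val : K → E))
    ⟨Subtype.val, continuous_subtype_val⟩ T hsmooth (w := mollify μ hφ v) fun y =>
      (mollify_apply μ hφ v y).trans <| Eq.symm <|
        integral_compacts_eq_integral μ K (g := fun z => mollifierKernel μ hφ v z y)
          fun z hz => congrArg (fun u : 𝓓_{L}(E, F) => u y) (hker z hz)
  exact h.trans <| integral_compacts_eq_integral μ K
    (g := fun z => T (mollifierKernel μ hφ v z)) fun z hz => by rw [hker z hz, map_zero]

end Mollification

/-! ### Regularization of currents in a chart -/

section Patches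

theorem contDiff_smul_of_tsupport_subset {E F : Type*} [NormedAddCommGroup E] [NormedSpace ℝ E]
    [NormedAddCommGroup F] [NormedSpace ℝ F] {ρ : E → ℝ} {w : E → F} {U : Set E} (hU : IsOpen U)
    (hρ : ContDiff ℝ ∞ ρ) (hs : tsupport ρ ⊆ U) (hw : ContDiffOn ℝ ∞ w U) :
    ContDiff ℝ ∞ (fun x => ρ x • w x) :=
  contMDiff_iff_contDiff.1 <| contMDiff_of_tsupport fun _ hx =>
    ((hρ.contDiffOn.smul hw).contDiffAt
      (hU.mem_nhds (hs (tsupport_smul_subset_left ρ w hx)))).contMDiffAt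

variable {n m : ℕ} {M : Type*} [TopologicalSpace M] [ChartedSpace (Euc n) M]
  {κ : Type*} {l : Filter κ}

theorem formsTendstoZero_testFormOf [T2Space M] {e : OpenPartialHomeomorph M (Euc n)}
    {L : Compacts (Euc n)} (he : e ∈ IsManifold.maximalAtlas (𝓡 n) ∞ M) (hLe : ↑L ⊆ e.target)
    [IsManifold (𝓡 n) ∞ M] {u : κ → 𝓓_{L}(Euc n, Alt n m)} (hu : Tendsto u l (𝓝 0)) :
    FormsTendstoZero l (fun k => testFormOf he hLe (u k)) := by
  refine .of_charts ⟨_, isCompact_symm_image hLe, fun k => formSupport_formOf_subset hLe (u k)⟩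
    fun x => ?_
  by_cases hx : x ∈ e.source
  · refine ⟨e, he, hx, (tendsto_zero_iff_jetsTendstoZero.1 hu (e x)).congr ?_⟩
    filter_upwards [tendsto_snd.eventually (e.open_target.mem_nhds (e.map_source hx))] with w hw
    exact (chartRep_formOf he _ hw).symm
  · refine ⟨chartAt (Euc n) x, IsManifold.chart_mem_maximalAtlas x, mem_chart_source _ x,
      .of_eventually_eq_zero ?_⟩
    have hxL : (chartAt (Euc n) x).symm (chartAt (Euc n) x x) ∉ e.symm '' L := by
      rw [(chartAt (Euc n) x).left_inv (mem_chart_source _ x)]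
      rintro ⟨z, hz, rfl⟩
      exact hx (e.map_target (hLe hz))
    filter_upwards [eventually_symm_notMem_image hLe (mem_chart_target _ x) hxL] with y hy k
    exact chartRep_eq_zero (formOf_eq_zero (u k) hy)

/-- The restriction of a current to the test forms supported in a compact subset of a chart, as
a continuous functional on vector-valued test functions. -/
def chartFunctional [T2Space M] [IsManifold (𝓡 n) ∞ M] {e : OpenPartialHomeomorph M (Euc n)}
    {L : Compacts (Euc n)} (he : e ∈ IsManifold.maximalAtlas (𝓡 n) ∞ M) (hLe : ↑L ⊆ e.target)
    (T : currents n m M) : 𝓓_{L}(Euc n, Alt n m) →L[ℝ] ℝ where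
  toLinearMap := T.1 ∘ₗ testFormOf he hLe
  cont := by
    have := (ContDiffMapSupportedIn.withSeminorms ℝ (Euc n) (Alt n m) ⊤ L).firstCountableTopology
    refine continuous_of_continuousAt_zero (T.1 ∘ₗ testFormOf he hLe) ?_
    rw [ContinuousAt, map_zero]
    exact (formsTendstoZero_testFormOf he hLe tendsto_id).tendsto_current T

variable (n M) in
/-- The data for regularizing currents in a chart: a smooth cutoff function supported in a
compact subset `core` of the chart, and a compact neighbourhood `hull` of `core` in the chart
which contains the `radius`-neighbourhood of `core`. -/
structure Patch where
  chart : OpenPartialHomeomorph M (Euc n)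
  chart_mem : chart ∈ IsManifold.maximalAtlas (𝓡 n) ∞ M
  cutoff : Euc n → ℝ
  contDiff_cutoff : ContDiff ℝ ∞ cutoff
  core : Compacts (Euc n)
  tsupport_cutoff_subset : tsupport cutoff ⊆ core
  hull : Compacts (Euc n)
  hull_subset_target : ↑hull ⊆ chart.target
  radius : ℝ
  radius_pos : 0 < radius
  cthickening_core_subset : Metric.cthickening radius (core : Set (Euc n)) ⊆ hull

namespace Patch

variable (p : Patch n M)

theorem core_subset_hull : p.core ≤ p.hull :=
  (Metric.self_subset_cthickening _).trans p.cthickening_core_subset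

theorem core_subset_target : ↑p.core ⊆ p.chart.target :=
  Subset.trans p.core_subset_hull p.hull_subset_target

/-- The cutoff function as a function on `M`. -/
def weight : M → ℝ := p.chart.source.indicator (p.cutoff ∘ p.chart)

/-- The product of a test form with the cutoff function, in the coordinates of the chart. -/
def localize : testForms n M m →ₗ[ℝ] 𝓓_{p.core}(Euc n, Alt n m) where
  toFun α := .of_support_subset (f := fun y => p.cutoff y • chartRep p.chart α.1 y)
    (contDiff_smul_of_tsupport_subset p.chart.open_target p.contDiff_cutoff
      (p.tsupport_cutoff_subset.trans p.core_subset_target) (α.2.1 p.chart p.chart_mem))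
    ((subset_tsupport _).trans
      ((tsupport_smul_subset_left _ _).trans p.tsupport_cutoff_subset))
  map_add' α β := by
    ext1 y
    exact smul_add (p.cutoff y) (chartRep p.chart α.1 y) (chartRep p.chart β.1 y)
  map_smul' c α := by
    ext1 y
    exact smul_comm (p.cutoff y) c (chartRep p.chart α.1 y)

theorem tendsto_localize_zero {α : κ → testForms n M m} (h : FormsTendstoZero l α) :
    Tendsto (fun k => p.localize (α k)) l (𝓝 0) := by
  refine tendsto_zero_iff_jetsTendstoZero.2 fun y => ?_
  by_cases hy : y ∈ p.chart.target
  · have hA : ContDiff ℝ ∞ fun y => p.cutoff y • ContinuousLinearMap.id ℝ (Alt n m) :=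
      p.contDiff_cutoff.smul contDiff_const
    exact (h.jetsTendstoZero p.chart p.chart_mem y hy).substitution (I := 𝓘(ℝ, ℝ))
      (A := fun _ y => p.cutoff y • ContinuousLinearMap.id ℝ (Alt n m)) (θ := fun _ y => y)
      (tendsto_const_nhds (x := (0 : ℝ))) isOpen_univ (mem_univ _)
      (hA.contMDiff.comp contMDiff_snd).contMDiffOn contMDiffOn_snd
  · have hyK : y ∉ (p.core : Set (Euc n)) := fun h => hy (p.core_subset_target h)
    refine .of_eventually_eq_zero ?_
    filter_upwards [p.core.isCompact.isClosed.isOpen_compl.mem_nhds hyK] with z hz k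
    exact (p.localize (α k)).zero_on_compl hz

theorem tendsto_localize {β : κ → testForms n M m} {β₀ : testForms n M m}
    (h : FormsTendstoZero l (fun k => β k - β₀)) :
    Tendsto (fun k => p.localize (β k)) l (𝓝 (p.localize β₀)) := by
  rw [← tendsto_sub_nhds_zero_iff]
  simpa only [map_sub] using p.tendsto_localize_zero h

theorem localize_eq_zero {α : testForms n M m}
    (h : ∀ x, p.weight x ≠ 0 → (α : FormField n M m) x = 0) : p.localize α = 0 := by
  ext1 y
  change p.cutoff y • chartRep p.chart α.1 y = 0
  by_cases hy : p.cutoff y = 0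
  · rw [hy, zero_smul]
  · have hyt : y ∈ p.chart.target :=
      p.core_subset_target (p.tsupport_cutoff_subset (subset_tsupport _ hy))
    rw [chartRep_eq_zero (h _ ?_), smul_zero]
    rwa [weight, indicator_of_mem (p.chart.map_target hyt), Function.comp_apply,
      p.chart.right_inv hyt]

/-- A mollifier whose radius is at most `p.radius` and, for `0 < ε`, at most `ε`. -/
def bump (ε : ℝ) : ContDiffBump (0 : Euc n) where
  rIn := min p.radius (if 0 < ε then ε else 1) / 2
  rOut := min p.radius (if 0 < ε then ε else 1)
  rIn_pos := half_pos (lt_min p.radius_pos (by split_ifs <;> positivity))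
  rIn_lt_rOut := half_lt_self (lt_min p.radius_pos (by split_ifs <;> positivity))

theorem tendsto_rOut_bump : Tendsto (fun ε => (p.bump ε).rOut) (𝓝[>] 0) (𝓝 0) := by
  refine tendsto_of_tendsto_of_tendsto_of_le_of_le' tendsto_const_nhds
    (tendsto_id.mono_left nhdsWithin_le_nhds) (.of_forall fun ε => (p.bump ε).rOut_pos.le) ?_
  filter_upwards [self_mem_nhdsWithin] with ε hε
  exact (min_le_right _ _).trans_eq (if_pos hε)

theorem cthickening_rOut_subset (ε : ℝ) :
    Metric.cthickening (p.bump ε).rOut (p.core : Set (Euc n)) ⊆ (p.hull : Set (Euc n)) :=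
  (Metric.cthickening_mono (min_le_left _ _) _).trans p.cthickening_core_subset

variable [T2Space M]

/-- The product of a test form with the cutoff function, as a test form on `M`. -/
def restrict (β : testForms n M m) : testForms n M m :=
  testFormOf p.chart_mem p.hull_subset_target (ContDiffMapSupportedIn.monoCLM ℝ (p.localize β))

theorem restrict_apply (β : testForms n M m) (x : M) :
    (p.restrict β : FormField n M m) x = p.weight x • (β : FormField n M m) x := by
  have hmono : ⇑(ContDiffMapSupportedIn.monoCLM ℝ (p.localize β) : 𝓓_{p.hull}(Euc n, Alt n m)) =
      p.localize β := by
    rw [ContDiffMapSupportedIn.monoCLM_apply, if_pos ⟨le_rfl, p.core_subset_hull⟩]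
  change formOf p.chart (ContDiffMapSupportedIn.monoCLM ℝ (p.localize β)) x = _
  rw [hmono]
  by_cases hx : x ∈ p.chart.source
  · rw [weight, indicator_of_mem hx]
    exact formOf_chartRep p.chart_mem p.cutoff β.1 hx
  · rw [formOf_of_notMem hx, weight, indicator_of_notMem hx, zero_smul]

variable [IsManifold (𝓡 n) ∞ M]

/-- The restriction of `T` to test forms supported in the hull of the patch. -/
def functional (T : currents n m M) : 𝓓_{p.hull}(Euc n, Alt n m) →L[ℝ] ℝ :=
  chartFunctional p.chart_mem p.hull_subset_target T

/-- The mollification at scale `ε` of the product of a current with the cutoff function. -/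
def regularize (ε : ℝ) : currents n m M →ₗ[ℝ] currents n m M where
  toFun T := ⟨(p.functional T ∘L mollify volume (p.cthickening_rOut_subset ε)).toLinearMap ∘ₗ
    p.localize, fun _ hα => by
      have h := ((p.functional T ∘L
        mollify volume (p.cthickening_rOut_subset ε)).continuous.tendsto 0).comp
        (p.tendsto_localize_zero (formsTendstoZero_atTop_iff.2 hα))
      rwa [map_zero] at h⟩
  map_add' _ _ := rfl
  map_smul' _ _ := rfl

theorem tendsto_regularize (T : currents n m M) {ε : κ → ℝ} (hε : Tendsto ε l (𝓝[>] 0))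
    {β : κ → testForms n M m} {β₀ : testForms n M m}
    (hβ : FormsTendstoZero l (fun k => β k - β₀)) :
    Tendsto (fun k => (p.regularize (ε k) T).1 (β k)) l (𝓝 (T.1 (p.restrict β₀))) :=
  ((p.functional T).continuous.tendsto _).comp <|
    tendsto_mollify volume p.core_subset_hull (fun k => p.cthickening_rOut_subset (ε k))
      (p.tendsto_rOut_bump.comp hε) (p.tendsto_localize hβ)

theorem regularize_eq_zero (ε : ℝ) (T : currents n m M) {α : testForms n M m}
    (h : ∀ x, p.weight x ≠ 0 → (α : FormField n M m) x = 0) : (p.regularize ε T).1 α = 0 :=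
  (congrArg (p.functional T ∘L mollify volume (p.cthickening_rOut_subset ε))
    (p.localize_eq_zero h)).trans (map_zero _)

/-- The product of a constant form with the cutoff function, in the coordinates of the chart. -/
def constForm : Alt n m →ₗ[ℝ] 𝓓_{p.core}(Euc n, Alt n m) where
  toFun a := .of_support_subset (f := fun y => p.cutoff y • a)
    (p.contDiff_cutoff.smul contDiff_const)
    ((Function.support_smul_subset_left _ _).trans
      ((subset_tsupport _).trans p.tsupport_cutoff_subset))
  map_add' a b := by
    ext1 y
    exact smul_add (p.cutoff y) a b
  map_smul' c a := by
    ext1 y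
    exact smul_comm (p.cutoff y) c a

/-- The density of the current `p.regularize ε T` in the chart of the patch. -/
def density (ε : ℝ) (T : currents n m M) (z : Euc n) : Alt n m →L[ℝ] ℝ :=
  LinearMap.toContinuousLinearMap
    { toFun a := p.functional T
        (mollifierKernel volume (p.cthickening_rOut_subset ε) (p.constForm a) z)
      map_add' a b := by
        rw [← map_add]
        congr 1
        ext1 x
        exact (congrArg _ (smul_add (p.cutoff z) a b)).trans
          (smul_add ((p.bump ε).normed volume (x - z)) _ _)
      map_smul' c a := by
        rw [RingHom.id_apply, ← map_smul]
        congr 1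
        ext1 x
        exact (congrArg _ (smul_comm (p.cutoff z) c a)).trans
          (smul_comm ((p.bump ε).normed volume (x - z)) c _) }

theorem contDiff_density (ε : ℝ) (T : currents n m M) : ContDiff ℝ ∞ (p.density ε T) :=
  contDiff_clm_apply_iff.2 fun a => contDiff_clm_apply_kernel (p.functional T)
    (contDiff_mollifierKernel volume (p.cthickening_rOut_subset ε) (p.constForm a))

theorem support_density_subset (ε : ℝ) (T : currents n m M) :
    Function.support (p.density ε T) ⊆ p.core := fun z hz => by_contra fun hzK => hz <| by
  ext a
  have hker : mollifierKernel volume (p.cthickening_rOut_subset ε) (p.constForm a) z = 0 := by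
    ext1 x
    exact (congrArg _ ((p.constForm a).zero_on_compl hzK)).trans (smul_zero _)
  exact (congrArg (p.functional T) hker).trans (map_zero _)

theorem regularize_apply (ε : ℝ) (T : currents n m M) (α : testForms n M m) :
    (p.regularize ε T).1 α = ∫ z, p.density ε T z (chartRep p.chart (α : FormField n M m) z) :=
  clm_mollify volume (p.functional T) (p.cthickening_rOut_subset ε) (p.localize α)

end Patch

end Patches

section Partition

variable {n m : ℕ} {M : Type*} [TopologicalSpace M] [ChartedSpace (Euc n) M]

theorem Patch.exists_weight_eq {e : OpenPartialHomeomorph M (Euc n)}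
    (he : e ∈ IsManifold.maximalAtlas (𝓡 n) ∞ M) {f : M → ℝ} (hf : ContMDiff (𝓡 n) 𝓘(ℝ) ∞ f)
    (hfc : HasCompactSupport f) (hfe : tsupport f ⊆ e.source) :
    ∃ p : Patch n M, p.weight = f := by
  let K : Compacts (Euc n) :=
    ⟨e '' tsupport f, IsCompact.image_of_continuousOn hfc (e.continuousOn.mono hfe)⟩
  have hKe : ↑K ⊆ e.target := by
    rintro _ ⟨x, hx, rfl⟩
    exact e.map_source (hfe hx)
  let ρ : Euc n → ℝ := e.target.indicator (f ∘ e.symm)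
  have hρK : tsupport ρ ⊆ K := by
    refine closure_minimal (fun y hy => ?_) K.isCompact.isClosed
    have hyt : y ∈ e.target := mem_of_indicator_ne_zero hy
    have hfy : f (e.symm y) ≠ 0 := fun h => hy ((indicator_of_mem hyt _).trans h)
    exact ⟨e.symm y, subset_tsupport _ hfy, e.right_inv hyt⟩
  have hρ : ContDiff ℝ ∞ ρ := by
    refine contMDiff_iff_contDiff.1 (contMDiff_of_tsupport fun y hy => ?_)
    have hyt : y ∈ e.target := hKe (hρK hy)
    refine (hf.contMDiffAt.comp y (contMDiffAt_symm_of_mem he hyt)).congr_of_eventuallyEq ?_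
    filter_upwards [e.open_target.mem_nhds hyt] with z hz using indicator_of_mem hz _
  obtain ⟨δ, hδ, hδe⟩ := K.isCompact.exists_cthickening_subset_open e.open_target hKe
  refine ⟨⟨e, he, ρ, hρ, K, hρK, ⟨_, K.isCompact.cthickening⟩, hδe, δ, hδ, subset_rfl⟩, ?_⟩
  funext x
  by_cases hx : x ∈ e.source
  · calc e.source.indicator (ρ ∘ e) x = ρ (e x) := indicator_of_mem hx _
      _ = f (e.symm (e x)) := indicator_of_mem (e.map_source hx) _
      _ = f x := congrArg f (e.left_inv hx)
  · exact (indicator_of_notMem hx _).trans <| Eq.symm <|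
      image_eq_zero_of_notMem_tsupport fun h => hx (hfe h)

variable [T2Space M]

theorem sum_restrict_eq {ι : Type*} (p : ι → Patch n M) (s : Finset ι) {β : testForms n M m}
    (hs : ∀ x ∈ formSupport (β : FormField n M m), ∑ i ∈ s, (p i).weight x = 1) :
    ∑ i ∈ s, (p i).restrict β = β := by
  refine Subtype.ext (funext fun x => ?_)
  rw [Submodule.coe_sum, Finset.sum_apply,
    Finset.sum_congr rfl fun i _ => (p i).restrict_apply β x, ← Finset.sum_smul]
  by_cases hx : x ∈ formSupport (β : FormField n M m)
  · rw [hs x hx, one_smul]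
  · rw [notMem_formSupport hx, smul_zero]

variable [IsManifold (𝓡 n) ∞ M]

variable (n M) in
theorem exists_smoothPartitionOfUnity_subordinate_charts [SecondCountableTopology M] :
    ∃ f : SmoothPartitionOfUnity M (𝓡 n) M univ, ∀ x, HasCompactSupport (f x) ∧
      tsupport (f x) ⊆ (chartAt (Euc n) x).source := by
  have : LocallyCompactSpace M := ChartedSpace.locallyCompactSpace (Euc n) M
  have hU (x : M) : ∃ U : Set M, IsOpen U ∧ x ∈ U ∧ IsCompact (closure U) ∧
      closure U ⊆ (chartAt (Euc n) x).source := by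
    obtain ⟨U, hU, hxU, hUs, hUc⟩ := exists_open_between_and_isCompact_closure
      (isCompact_singleton (x := x)) (chartAt (Euc n) x).open_source
      (singleton_subset_iff.2 (mem_chart_source _ x))
    exact ⟨U, hU, singleton_subset_iff.1 hxU, hUc, hUs⟩
  choose U hUo hxU hUc hUs using hU
  obtain ⟨f, hf⟩ := SmoothPartitionOfUnity.exists_isSubordinate (𝓡 n) isClosed_univ U hUo
    fun x _ => mem_iUnion.2 ⟨x, hxU x⟩
  exact ⟨f, fun x => ⟨(hUc x).of_isClosed_subset isClosed_closure
    ((hf x).trans subset_closure), (hf x).trans (subset_closure.trans (hUs x))⟩⟩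

variable (n M) in
theorem exists_patches [SecondCountableTopology M] :
    ∃ p : M → Patch n M, LocallyFinite (fun i => Function.support (p i).weight) ∧
      ∀ x, ∑ᶠ i, (p i).weight x = 1 := by
  obtain ⟨f, hf⟩ := exists_smoothPartitionOfUnity_subordinate_charts n M
  choose p hp using fun i => Patch.exists_weight_eq (IsManifold.chart_mem_maximalAtlas i)
    (f i).contMDiff (hf i).1 (hf i).2
  refine ⟨p, ?_, fun x => ?_⟩
  · simpa only [hp] using f.locallyFinite
  · simpa only [hp] using f.sum_eq_one (mem_univ x)

theorem tendsto_sum_regularize {ι κ : Type*} {l : Filter κ} {p : ι → Patch n M}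
    (hp : LocallyFinite fun i => Function.support (p i).weight)
    (hp₁ : ∀ x, ∑ᶠ i, (p i).weight x = 1) {s : κ → Finset ι}
    (hs : ∀ C : Set M, IsCompact C → ∀ᶠ k in l, ∀ i,
      (Function.support (p i).weight ∩ C).Nonempty → i ∈ s k)
    (T : currents n m M) {ε : κ → ℝ} (hε : Tendsto ε l (𝓝[>] 0)) {β : κ → testForms n M m}
    {β₀ : testForms n M m} (hβ : FormsTendstoZero l (fun k => β k - β₀)) :
    Tendsto (fun k => ∑ i ∈ s k, ((p i).regularize (ε k) T).1 (β k)) l (𝓝 (T.1 β₀)) := by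
  obtain ⟨C, hC, hβC, hβ₀C⟩ : ∃ C : Set M, IsCompact C ∧
      (∀ k, formSupport (β k : FormField n M m) ⊆ C) ∧
        formSupport (β₀ : FormField n M m) ⊆ C := by
    obtain ⟨K, hK, hKβ⟩ := hβ.exists_isCompact
    refine ⟨K ∪ formSupport β₀.1, hK.union β₀.2.2, fun k => ?_, subset_union_right⟩
    have h := formSupport_add (β k - β₀ : testForms n M m).1 β₀.1
    rw [← Submodule.coe_add, sub_add_cancel] at h
    exact h.trans (union_subset_union_left _ (hKβ k))
  have hfin := hp.finite_nonempty_inter_compact hC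
  have hsum : ∑ i ∈ hfin.toFinset, (p i).restrict β₀ = β₀ := by
    refine sum_restrict_eq p _ fun x hx => ?_
    rw [← hp₁ x]
    refine (finsum_eq_sum_of_support_subset _ fun i hi => ?_).symm
    rw [Finite.coe_toFinset]
    exact ⟨x, hi, hβ₀C hx⟩
  rw [← hsum, map_sum]
  refine (tendsto_finsetSum _ fun i _ => (p i).tendsto_regularize T hε hβ).congr' ?_
  filter_upwards [hs C hC] with k hk
  refine Finset.sum_subset (fun i hi => hk i (hfin.mem_toFinset.1 hi)) fun i _ hi => ?_
  refine (p i).regularize_eq_zero (ε k) T fun x hx => notMem_formSupport fun hxβ => hi ?_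
  exact hfin.mem_toFinset.2 ⟨x, hx, hβC k hxβ⟩

variable (n M) in
theorem exists_regularization [SecondCountableTopology M] :
    ∃ (p : M → Patch n M) (s : ℝ → Finset M), ∀ (m : ℕ) (T : currents n m M)
      (κ : Type*) (l : Filter κ) (ε : κ → ℝ) (β : κ → testForms n M m) (β₀ : testForms n M m),
      Tendsto ε l (𝓝[>] 0) → FormsTendstoZero l (fun k => β k - β₀) →
        Tendsto (fun k => ∑ i ∈ s (ε k), ((p i).regularize (ε k) T).1 (β k)) l (𝓝 (T.1 β₀)) := by
  have : LocallyCompactSpace M := ChartedSpace.locallyCompactSpace (Euc n) M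
  obtain ⟨p, hp, hp₁⟩ := exists_patches n M
  let K : CompactExhaustion M := default
  have hfin (ε : ℝ) := hp.finite_nonempty_inter_compact (K.isCompact ⌊ε⁻¹⌋₊)
  refine ⟨p, fun ε => (hfin ε).toFinset, fun m T κ l ε β β₀ hε hβ =>
    tendsto_sum_regularize hp hp₁ (fun C hC => ?_) T hε hβ⟩
  obtain ⟨N, hN⟩ := K.exists_superset_of_isCompact hC
  have hN' : ∀ᶠ ε : ℝ in 𝓝[>] 0, N ≤ ⌊ε⁻¹⌋₊ :=
    (tendsto_nat_floor_atTop.comp tendsto_inv_nhdsGT_zero).eventually_ge_atTop N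
  filter_upwards [hε.eventually hN'] with k hk i hi
  exact (hfin (ε k)).mem_toFinset.2 (hi.mono (inter_subset_inter_right _ (hN.trans (K.subset hk))))

end Partition

/-! ### Averages over compact families of diffeomorphisms -/

section CompactFamilies

theorem tendsto_integral_of_compactSpace {X κ : Type*} [TopologicalSpace X] [CompactSpace X]
    [MeasurableSpace X] [OpensMeasurableSpace X] (μ : Measure X) [IsFiniteMeasure μ]
    {l : Filter κ} {u : κ → X → ℝ} {u₀ : X → ℝ} (hu : ∀ k, Continuous (u k))
    (hu₀ : Continuous u₀)
    (h : ∀ x, Tendsto (fun w : κ × X => u w.1 w.2) (l ×ˢ 𝓝 x) (𝓝 (u₀ x))) :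
    Tendsto (fun k => ∫ x, u k x ∂μ) l (𝓝 (∫ x, u₀ x ∂μ)) := by
  have hunif : Tendsto (fun k => (⟨u k, hu k⟩ : C(X, ℝ))) l (𝓝 ⟨u₀, hu₀⟩) := by
    refine ContinuousMap.tendsto_iff_tendstoLocallyUniformly.2
      (tendstoLocallyUniformly_iff_forall_tendsto.2 fun x => ?_)
    refine Tendsto.mono_right ?_ (nhds_prod_eq.symm.trans_le (nhds_le_uniformity (u₀ x)))
    exact ((hu₀.tendsto x).comp tendsto_snd).prodMk (h x)
  exact ((integralCompact ℝ μ).continuous.tendsto _).comp hunif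

variable {n m : ℕ} {M : Type*} [TopologicalSpace M] [ChartedSpace (Euc n) M]
  {V B : Type*} [NormedAddCommGroup V] [NormedSpace ℝ V] [TopologicalSpace B]
  {I : ModelWithCorners ℝ V B} {P : Type*} [TopologicalSpace P] [ChartedSpace B P]
  {f : P → M ≃ₘ^∞⟮𝓡 n, 𝓡 n⟯ M}

theorem formSupport_sub (α β : FormField n M m) :
    formSupport (α - β) ⊆ formSupport α ∪ formSupport β := by
  rw [sub_eq_add_neg, ← neg_one_smul ℝ β]
  exact (formSupport_add α _).trans (union_subset_union_right _ (formSupport_smul _ β))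

variable (I) in
/-- The diffeomorphisms `f p` of `M` and their inverses depend smoothly on `p`. -/
structure IsSmoothFamily (f : P → M ≃ₘ^∞⟮𝓡 n, 𝓡 n⟯ M) : Prop where
  contMDiff : ContMDiff (I.prod (𝓡 n)) (𝓡 n) ∞ (Function.uncurry fun p => f p)
  contMDiff_symm : ContMDiff (I.prod (𝓡 n)) (𝓡 n) ∞ (Function.uncurry fun p => (f p).symm)

variable [IsManifold (𝓡 n) ∞ M]

theorem exists_isCompact_formSupport_pullback [CompactSpace P] (hf : IsSmoothFamily I f) {K : Set M}
    (hK : IsCompact K) :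
    ∃ L, IsCompact L ∧ ∀ (p : P) (α : testForms n M m), formSupport (α : FormField n M m) ⊆ K →
      formSupport (pullback (f p) α : FormField n M m) ⊆ L :=
  ⟨_, (isCompact_univ.prod hK).image hf.contMDiff_symm.continuous, fun p α hα x hx =>
    ⟨(p, f p x), ⟨mem_univ _, hα (formSupport_pullbackField (f p) α.1 hx)⟩,
      (f p).symm_apply_apply x⟩⟩

namespace IsSmoothFamily

variable [IsManifold I ∞ P] [CompactSpace P] (hf : IsSmoothFamily I f)

include hf

theorem formsTendstoZero_pullback {κ : Type*} {l : Filter κ} {π : κ → P} {p₀ : P}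
    (hπ : Tendsto π l (𝓝 p₀)) {α : κ → testForms n M m} (hα : FormsTendstoZero l α) :
    FormsTendstoZero l (fun k => pullback (f (π k)) (α k)) := by
  obtain ⟨K, hK, hαK⟩ := hα.exists_isCompact
  obtain ⟨L, hL, hKL⟩ := exists_isCompact_formSupport_pullback (m := m) hf hK
  refine .of_charts ⟨L, hL, fun k => hKL _ _ (hαK k)⟩ fun x => ?_
  have he := IsManifold.chart_mem_maximalAtlas (I := 𝓡 n) (n := ∞) x
  have he' := IsManifold.chart_mem_maximalAtlas (I := 𝓡 n) (n := ∞) (f p₀ x)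
  have hx : (chartAt (Euc n) x).symm (chartAt (Euc n) x x) = x :=
    (chartAt (Euc n) x).left_inv (mem_chart_source _ x)
  have h₀ : (p₀, chartAt (Euc n) x x) ∈
      familyDomain (fun p => f p) (chartAt (Euc n) x) (chartAt (Euc n) (f p₀ x)) :=
    ⟨mem_chart_target _ x, hx.symm ▸ mem_chart_source _ _⟩
  exact ⟨_, he, mem_chart_source _ x, jetsTendstoZero_chartRep_pullbackField hf.contMDiff hπ he
    he' h₀ (hα.jetsTendstoZero _ he' _ ((chartAt (Euc n) (f p₀ x)).map_source h₀.2))⟩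

theorem formsTendstoZero_pullback_sub (α : testForms n M m) (p₀ : P) :
    FormsTendstoZero (𝓝 p₀) (fun p => pullback (f p) α - pullback (f p₀) α) := by
  obtain ⟨L, hL, hαL⟩ := exists_isCompact_formSupport_pullback (m := m) hf α.2.2
  refine .of_charts ⟨L, hL, fun p => ?_⟩ fun x => ?_
  · exact (formSupport_sub _ _).trans (union_subset (hαL p α subset_rfl) (hαL p₀ α subset_rfl))
  · exact ⟨chartAt (Euc n) x, IsManifold.chart_mem_maximalAtlas x, mem_chart_source _ x,
      .sub_of_contMDiffOn (isOpen_univ.prod (chartAt (Euc n) x).open_target)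
        ⟨mem_univ _, mem_chart_target _ x⟩ (contMDiffOn_chartRep_pullbackField hf.contMDiff
          (IsManifold.chart_mem_maximalAtlas x) α.2.1)⟩

variable [FirstCountableTopology P]

theorem continuous_current_pullback (T : currents n m M) (α : testForms n M m) :
    Continuous fun p => T.1 (pullback (f p) α) :=
  continuous_iff_continuousAt.2 fun p₀ => tendsto_sub_nhds_zero_iff.1 <| by
    simpa only [map_sub] using (hf.formsTendstoZero_pullback_sub α p₀).tendsto_current T

variable [MeasurableSpace P] [OpensMeasurableSpace P] (μ : Measure P) [IsFiniteMeasure μ]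

/-- The average `∫ (f p)_* T dμ(p)` of the push-forwards of a current under a smooth family of
diffeomorphisms. -/
def average : currents n m M →ₗ[ℝ] currents n m M where
  toFun T := ⟨{
    toFun α := ∫ p, T.1 (pullback (f p) α) ∂μ
    map_add' α β := by
      simp only [map_add]
      exact integral_add (integrable_of_compactSpace μ (hf.continuous_current_pullback T α))
        (integrable_of_compactSpace μ (hf.continuous_current_pullback T β))
    map_smul' c α := by
      simp only [map_smul]
      exact integral_smul c _ }, fun α hα => by
    have h := tendsto_integral_of_compactSpace μ (u₀ := 0)
      (fun j => hf.continuous_current_pullback T (α j)) continuous_const fun p =>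
        (hf.formsTendstoZero_pullback tendsto_snd
          ((formsTendstoZero_atTop_iff.2 hα).comp_tendsto tendsto_fst)).tendsto_current T
    rwa [integral_zero'] at h⟩
  map_add' T S := Subtype.ext <| LinearMap.ext fun α =>
    integral_add (integrable_of_compactSpace μ (hf.continuous_current_pullback T α))
      (integrable_of_compactSpace μ (hf.continuous_current_pullback S α))
  map_smul' c T := Subtype.ext <| LinearMap.ext fun α => integral_smul c _

theorem average_apply (T : currents n m M) (α : testForms n M m) :
    (hf.average μ T).1 α = ∫ p, T.1 (pullback (f p) α) ∂μ := rfl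

end IsSmoothFamily

end CompactFamilies

/-! ### Smoothness of averages -/

theorem contDiff_continuousLinearMap_det (n : ℕ) :
    ContDiff ℝ ∞ (fun A : Euc n →L[ℝ] Euc n => A.det) := by
  let b := (EuclideanSpace.basisFun (Fin n) ℝ).toBasis
  have h : (fun A : Euc n →L[ℝ] Euc n => A.det) = fun A : Euc n →L[ℝ] Euc n =>
      ∑ σ : Equiv.Perm (Fin n), (Equiv.Perm.sign σ : ℝ) * ∏ i, (A (b i)) (σ i) := by
    funext A
    rw [ContinuousLinearMap.det, ← LinearMap.det_toMatrix b, Matrix.det_apply']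
    simp [LinearMap.toMatrix_apply, b]
  rw [h]
  refine ContDiff.sum fun σ _ => contDiff_const.mul (contDiff_prod fun i _ => ?_)
  exact (EuclideanSpace.proj (σ i)).contDiff.comp
    (ContinuousLinearMap.apply ℝ (Euc n) (b i)).contDiff

theorem continuous_of_continuousOn_of_eq_zero {X F : Type*} [TopologicalSpace X]
    [TopologicalSpace F] [Zero F] {f : X → F} {U C : Set X} (hU : IsOpen U) (hC : IsClosed C)
    (hCU : C ⊆ U) (hf : ContinuousOn f U) (h0 : ∀ x ∉ C, f x = 0) : Continuous f :=
  continuous_iff_continuousAt.2 fun x => by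
    by_cases hx : x ∈ U
    · exact hf.continuousAt (hU.mem_nhds hx)
    · refine (continuousAt_const (y := 0)).congr ?_
      filter_upwards [hC.isOpen_compl.mem_nhds fun h => hx (hCU h)] with y hy using (h0 y hy).symm

section PushedDensity

variable {n m : ℕ} {M : Type*} [TopologicalSpace M] {P : Type*} {f g : P → M → M}
  {e e' : OpenPartialHomeomorph M (Euc n)} {F : Euc n → Alt n m →L[ℝ] ℝ} {q : P × Euc n}

theorem mem_familyDomain_of_mem_inverse (hfg : ∀ p, Function.RightInverse (g p) (f p))
    (hq : q ∈ familyDomain g e' e) :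
    (q.1, familyRep g e' e q.1 q.2) ∈ familyDomain f e e' := by
  refine ⟨e.map_source hq.2, ?_⟩
  change f q.1 (e.symm (e (g q.1 (e'.symm q.2)))) ∈ e'.source
  rw [e.left_inv hq.2, hfg]
  exact e'.map_target hq.1

theorem familyRep_familyRep_inverse (hfg : ∀ p, Function.RightInverse (g p) (f p))
    (hq : q ∈ familyDomain g e' e) :
    familyRep f e e' q.1 (familyRep g e' e q.1 q.2) = q.2 := by
  change e' (f q.1 (e.symm (e (g q.1 (e'.symm q.2))))) = q.2
  rw [e.left_inv hq.2, hfg, e'.right_inv hq.1]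

theorem injOn_familyRep (hfg : ∀ p, Function.RightInverse (g p) (f p)) (p : P) :
    InjOn (familyRep g e' e p) {y | (p, y) ∈ familyDomain g e' e} :=
  LeftInvOn.injOn (f₁' := familyRep f e e' p) fun y hy =>
    familyRep_familyRep_inverse (q := (p, y)) hfg hy

theorem image_familyRep (hfg : ∀ p, Function.RightInverse (g p) (f p))
    (hgf : ∀ p, Function.LeftInverse (g p) (f p)) (p : P) :
    familyRep g e' e p '' {y | (p, y) ∈ familyDomain g e' e} =
      {z | (p, z) ∈ familyDomain f e e'} :=
  Subset.antisymm (image_subset_iff.2 fun _ hy => mem_familyDomain_of_mem_inverse hfg hy)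
    fun z hz => ⟨_, mem_familyDomain_of_mem_inverse (q := (p, z)) hgf hz,
      familyRep_familyRep_inverse (q := (p, z)) hgf hz⟩

/-- The density in the chart `e'` of the push-forward under `f p` of the current with density `F`
in the chart `e`, where `g p` is the inverse of `f p`. -/
def pushedDensity (f g : P → M → M) (e e' : OpenPartialHomeomorph M (Euc n))
    (F : Euc n → Alt n m →L[ℝ] ℝ) (p : P) (y : Euc n) : Alt n m →L[ℝ] ℝ :=
  (familyDomain g e' e).indicator (fun q => |(fderiv ℝ (familyRep g e' e q.1) q.2).det| •
    (F (familyRep g e' e q.1 q.2)).comp (ContinuousAlternatingMap.compContinuousLinearMapCLM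
      (fderiv ℝ (familyRep f e e' q.1) (familyRep g e' e q.1 q.2)))) (p, y)

theorem pushedDensity_of_mem (hq : q ∈ familyDomain g e' e) :
    pushedDensity f g e e' F q.1 q.2 = |(fderiv ℝ (familyRep g e' e q.1) q.2).det| •
      (F (familyRep g e' e q.1 q.2)).comp (ContinuousAlternatingMap.compContinuousLinearMapCLM
        (fderiv ℝ (familyRep f e e' q.1) (familyRep g e' e q.1 q.2))) :=
  indicator_of_mem hq _

theorem pushedDensity_of_notMem (hq : q ∉ familyDomain g e' e) :
    pushedDensity f g e e' F q.1 q.2 = 0 :=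
  indicator_of_notMem hq _

theorem eventually_pushedDensity_eq_zero [TopologicalSpace P] [T2Space M]
    (hg : Continuous (Function.uncurry g)) {K : Compacts (Euc n)} (hFK : Function.support F ⊆ K)
    (hKe : ↑K ⊆ e.target) (hq : q.2 ∈ e'.target) (hqd : q ∉ familyDomain g e' e) :
    ∀ᶠ w in 𝓝 q, pushedDensity f g e e' F w.1 w.2 = 0 := by
  have hcont : ContinuousAt (fun w : P × Euc n => g w.1 (e'.symm w.2)) q :=
    hg.continuousAt.comp (continuousAt_fst.prodMk
      ((e'.symm.continuousAt hq).comp continuousAt_snd))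
  have hnot : g q.1 (e'.symm q.2) ∉ e.symm '' K := by
    rintro ⟨z, hz, hzq⟩
    exact hqd ⟨hq, hzq ▸ e.map_target (hKe hz)⟩
  filter_upwards [hcont.preimage_mem_nhds
    ((isCompact_symm_image hKe).isClosed.isOpen_compl.mem_nhds hnot)] with w hw
  by_cases hwd : w ∈ familyDomain g e' e
  · have hFw : F (familyRep g e' e w.1 w.2) = 0 :=
      Function.notMem_support.1 fun h => hw ⟨_, hFK h, e.left_inv hwd.2⟩
    rw [pushedDensity_of_mem hwd, hFw, ContinuousLinearMap.zero_comp, smul_zero]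
  · exact pushedDensity_of_notMem hwd

variable {V B : Type*} [NormedAddCommGroup V] [NormedSpace ℝ V] [TopologicalSpace B]
  {I : ModelWithCorners ℝ V B} [TopologicalSpace P] [ChartedSpace B P] [ChartedSpace (Euc n) M]

theorem differentiableAt_familyRep (hf : ContMDiff (I.prod (𝓡 n)) (𝓡 n) ∞ (Function.uncurry f))
    (he : e ∈ IsManifold.maximalAtlas (𝓡 n) ∞ M) (he' : e' ∈ IsManifold.maximalAtlas (𝓡 n) ∞ M)
    (hq : q ∈ familyDomain f e e') : DifferentiableAt ℝ (familyRep f e e' q.1) q.2 :=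
  (contDiffAt_of_contMDiffAt_uncurry (contMDiffAt_familyRep hf he he' hq)).differentiableAt
    (by simp)

theorem det_fderiv_familyRep_ne_zero
    (hf : ContMDiff (I.prod (𝓡 n)) (𝓡 n) ∞ (Function.uncurry f))
    (hg : ContMDiff (I.prod (𝓡 n)) (𝓡 n) ∞ (Function.uncurry g))
    (hfg : ∀ p, Function.RightInverse (g p) (f p))
    (he : e ∈ IsManifold.maximalAtlas (𝓡 n) ∞ M) (he' : e' ∈ IsManifold.maximalAtlas (𝓡 n) ∞ M)
    (hq : q ∈ familyDomain g e' e) : (fderiv ℝ (familyRep g e' e q.1) q.2).det ≠ 0 := by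
  have hcomp := (differentiableAt_familyRep hf he he'
    (mem_familyDomain_of_mem_inverse hfg hq)).hasFDerivAt.comp q.2
      (differentiableAt_familyRep hg he' he hq).hasFDerivAt
  have hid : familyRep f e e' q.1 ∘ familyRep g e' e q.1 =ᶠ[𝓝 q.2] id := by
    filter_upwards [((isOpen_familyDomain hg.continuous).preimage
      (Continuous.prodMk_right q.1)).mem_nhds hq] with y hy
    exact familyRep_familyRep_inverse hfg hy
  have hmul := congrArg ContinuousLinearMap.det
    (hcomp.unique (hid.hasFDerivAt_iff.2 (hasFDerivAt_id q.2)))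
  rw [ContinuousLinearMap.det, ContinuousLinearMap.toLinearMap_comp, LinearMap.det_comp] at hmul
  exact right_ne_zero_of_mul_eq_one (hmul.trans LinearMap.det_id)

theorem integral_chartRep_pullbackField
    (hf : ContMDiff (I.prod (𝓡 n)) (𝓡 n) ∞ (Function.uncurry f))
    (hg : ContMDiff (I.prod (𝓡 n)) (𝓡 n) ∞ (Function.uncurry g))
    (hfg : ∀ p, Function.RightInverse (g p) (f p)) (hgf : ∀ p, Function.LeftInverse (g p) (f p))
    (he : e ∈ IsManifold.maximalAtlas (𝓡 n) ∞ M) (he' : e' ∈ IsManifold.maximalAtlas (𝓡 n) ∞ M)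
    (hF : Function.support F ⊆ e.target) {α : FormField n M m}
    (hα : ∀ x ∉ e'.source, α x = 0) (p : P) :
    ∫ z, F z (chartRep e (pullbackField (f p) α) z) =
      ∫ y in e'.target, pushedDensity f g e e' F p y (chartRep e' α y) := by
  let W : Set (Euc n) := {y | (p, y) ∈ familyDomain g e' e}
  have hW : IsOpen W := (isOpen_familyDomain hg.continuous).preimage (Continuous.prodMk_right p)
  have hzero (z : Euc n) (hz : z ∉ familyRep g e' e p '' W) :
      F z (chartRep e (pullbackField (f p) α) z) = 0 := by
    by_cases hze : z ∈ e.target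
    · have hαz : α (f p (e.symm z)) = 0 := hα _ fun h =>
        hz ((image_familyRep hfg hgf p).symm ▸ ⟨hze, h⟩)
      rw [chartRep_eq_zero (by rw [pullbackField, hαz]; rfl), map_zero]
    · rw [Function.notMem_support.1 fun h => hze (hF h), zero_apply]
  calc ∫ z, F z (chartRep e (pullbackField (f p) α) z)
      = ∫ z in familyRep g e' e p '' W, F z (chartRep e (pullbackField (f p) α) z) :=
        (setIntegral_eq_integral_of_forall_compl_eq_zero hzero).symm
    _ = ∫ y in W, |(fderiv ℝ (familyRep g e' e p) y).det| • F (familyRep g e' e p y)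
          (chartRep e (pullbackField (f p) α) (familyRep g e' e p y)) :=
        integral_image_eq_integral_abs_det_fderiv_smul volume hW.measurableSet (fun y hy =>
          (differentiableAt_familyRep (q := (p, y)) hg he' he hy).hasFDerivAt.hasFDerivWithinAt)
          (injOn_familyRep hfg p) _
    _ = ∫ y in W, pushedDensity f g e e' F p y (chartRep e' α y) := by
        refine setIntegral_congr_fun hW.measurableSet fun y hy => ?_
        have hy' := mem_familyDomain_of_mem_inverse (q := (p, y)) hfg hy
        have hrep := chartRep_pullbackField_family hf he he' α hy'
        rw [familyRep_familyRep_inverse (q := (p, y)) hfg hy] at hrep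
        simp only [hrep, pushedDensity_of_mem (q := (p, y)) hy]
        rfl
    _ = ∫ y in e'.target, pushedDensity f g e e' F p y (chartRep e' α y) :=
        (setIntegral_eq_of_subset_of_forall_sdiff_eq_zero e'.open_target.measurableSet
          (fun y hy => hy.1) fun y hy => by
            rw [pushedDensity_of_notMem (q := (p, y)) hy.2, zero_apply]).symm

variable [IsManifold I ∞ P]

theorem contMDiffAt_pushedDensity
    (hf : ContMDiff (I.prod (𝓡 n)) (𝓡 n) ∞ (Function.uncurry f))
    (hg : ContMDiff (I.prod (𝓡 n)) (𝓡 n) ∞ (Function.uncurry g))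
    (hfg : ∀ p, Function.RightInverse (g p) (f p))
    (he : e ∈ IsManifold.maximalAtlas (𝓡 n) ∞ M) (he' : e' ∈ IsManifold.maximalAtlas (𝓡 n) ∞ M)
    (hF : ContDiff ℝ ∞ F) (hq : q ∈ familyDomain g e' e) :
    ContMDiffAt (I.prod (𝓡 n)) 𝓘(ℝ, Alt n m →L[ℝ] ℝ) ∞
      (Function.uncurry (pushedDensity f g e e' F)) q := by
  have hτ := contMDiffAt_familyRep hg he' he hq
  have hdet : ContMDiffAt (I.prod (𝓡 n)) 𝓘(ℝ, ℝ) ∞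
      (fun q : P × Euc n => |(fderiv ℝ (familyRep g e' e q.1) q.2).det|) q :=
    ((contDiffAt_abs (det_fderiv_familyRep_ne_zero hf hg hfg he he' hq)).comp _
      (contDiff_continuousLinearMap_det n).contDiffAt).contMDiffAt.comp q
        (contMDiffAt_fderiv_familyRep hg he' he hq)
  have hDσ := ContMDiffAt.comp q (f := fun q : P × Euc n => (q.1, familyRep g e' e q.1 q.2))
    (contMDiffAt_fderiv_familyRep hf he he' (mem_familyDomain_of_mem_inverse hfg hq))
    (contMDiffAt_fst.prodMk hτ)
  have hC := ContMDiffAt.comp q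
    (contDiff_compContinuousLinearMapCLM n m).contMDiff.contMDiffAt hDσ
  have hFτ := ContMDiffAt.comp q hF.contMDiff.contMDiffAt hτ
  refine ContMDiffAt.congr_of_eventuallyEq (hdet.smul (I := 𝓘(ℝ, ℝ)) (hFτ.clm_comp hC)) ?_
  filter_upwards [(isOpen_familyDomain hg.continuous).mem_nhds hq] with w hw using
    pushedDensity_of_mem hw

theorem contMDiffOn_pushedDensity [T2Space M]
    (hf : ContMDiff (I.prod (𝓡 n)) (𝓡 n) ∞ (Function.uncurry f))
    (hg : ContMDiff (I.prod (𝓡 n)) (𝓡 n) ∞ (Function.uncurry g))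
    (hfg : ∀ p, Function.RightInverse (g p) (f p))
    (he : e ∈ IsManifold.maximalAtlas (𝓡 n) ∞ M) (he' : e' ∈ IsManifold.maximalAtlas (𝓡 n) ∞ M)
    (hF : ContDiff ℝ ∞ F) {K : Compacts (Euc n)} (hFK : Function.support F ⊆ K)
    (hKe : ↑K ⊆ e.target) :
    ContMDiffOn (I.prod (𝓡 n)) 𝓘(ℝ, Alt n m →L[ℝ] ℝ) ∞
      (Function.uncurry (pushedDensity f g e e' F)) (univ ×ˢ e'.target) := by
  refine fun q hq => ContMDiffAt.contMDiffWithinAt ?_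
  by_cases hqd : q ∈ familyDomain g e' e
  · exact contMDiffAt_pushedDensity hf hg hfg he he' hF hqd
  · exact (contMDiffAt_const (c := 0)).congr_of_eventuallyEq
      (eventually_pushedDensity_eq_zero hg.continuous hFK hKe hq.2 hqd)

end PushedDensity

section Coefficients

variable {n m : ℕ} {M : Type*} [TopologicalSpace M] [ChartedSpace (Euc n) M]
  {e : OpenPartialHomeomorph M (Euc n)} {α : testForms n M m}

theorem isCompact_image_formSupport (hα : formSupport α.1 ⊆ e.source) :
    IsCompact (e '' formSupport α.1) :=
  α.2.2.image_of_continuousOn (e.continuousOn.mono hα)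

theorem image_formSupport_subset_target {α : FormField n M m} (hα : formSupport α ⊆ e.source) :
    e '' formSupport α ⊆ e.target :=
  image_subset_iff.2 fun _ hx => e.map_source (hα hx)

theorem chartRep_eq_zero_of_notMem_image {α : FormField n M m} {y : Euc n} (hy : y ∈ e.target)
    (hyα : y ∉ e '' formSupport α) : chartRep e α y = 0 :=
  chartRep_eq_zero <| notMem_formSupport fun h => hyα ⟨_, h, e.right_inv hy⟩

theorem integrableOn_coefficient_apply (he : e ∈ IsManifold.maximalAtlas (𝓡 n) ∞ M)
    {c : Euc n → Alt n m →L[ℝ] ℝ} (hc : ContinuousOn c e.target)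
    (hα : formSupport α.1 ⊆ e.source) :
    IntegrableOn (fun y => c y (chartRep e α.1 y)) e.target :=
  (((hc.clm_apply (α.2.1 e he).continuousOn).mono
    (image_formSupport_subset_target hα)).integrableOn_compact
      (isCompact_image_formSupport hα)).of_forall_sdiff_eq_zero e.open_target.measurableSet
        fun y hy => by rw [chartRep_eq_zero_of_notMem_image hy.1 hy.2, map_zero]

theorem integral_setIntegral_coefficient_apply {X : Type*} [TopologicalSpace X] [CompactSpace X]
    [MeasurableSpace X] [OpensMeasurableSpace X] (μ : Measure X) [IsFiniteMeasure μ]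
    (he : e ∈ IsManifold.maximalAtlas (𝓡 n) ∞ M) {c : X → Euc n → Alt n m →L[ℝ] ℝ}
    (hc : ContinuousOn (Function.uncurry c) (univ ×ˢ e.target))
    (hα : formSupport α.1 ⊆ e.source) :
    ∫ x, (∫ y in e.target, c x y (chartRep e α.1 y)) ∂μ =
      ∫ y in e.target, (∫ x, c x y ∂μ) (chartRep e α.1 y) := by
  let j : X → Euc n → ℝ := fun x => e.target.indicator fun y => c x y (chartRep e α.1 y)
  have hK := isCompact_image_formSupport hα
  have hj0 : ∀ q ∉ (univ : Set X) ×ˢ (e '' formSupport α.1), j q.1 q.2 = 0 := fun q hq =>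
    indicator_apply_eq_zero.2 fun hy => by
      rw [chartRep_eq_zero_of_notMem_image hy fun h => hq ⟨mem_univ _, h⟩, map_zero]
  have hjc : Continuous (Function.uncurry j) := by
    refine continuous_of_continuousOn_of_eq_zero (isOpen_univ.prod e.open_target)
      (isClosed_univ.prod hK.isClosed) (prod_mono_right (image_formSupport_subset_target hα))
      ((hc.clm_apply (g := fun q : X × Euc n => chartRep e α.1 q.2)
        ((α.2.1 e he).continuousOn.comp continuousOn_snd fun q hq => hq.2)).congr
          fun q hq => ?_) hj0
    exact indicator_of_mem (f := fun y => c q.1 y (chartRep e α.1 y)) hq.2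
  calc ∫ x, (∫ y in e.target, c x y (chartRep e α.1 y)) ∂μ = ∫ x, (∫ y, j x y) ∂μ := by
        simp only [j, integral_indicator e.open_target.measurableSet]
    _ = ∫ y, (∫ x, j x y ∂μ) := integral_integral_swap_of_hasCompactSupport hjc
        (.intro' (isCompact_univ.prod hK) (isClosed_univ.prod hK.isClosed) hj0)
    _ = ∫ y in e.target, (∫ x, j x y ∂μ) :=
        (setIntegral_eq_integral_of_forall_compl_eq_zero fun y hy => by
          simp only [j, indicator_of_notMem hy, integral_zero]).symm
    _ = ∫ y in e.target, (∫ x, c x y ∂μ) (chartRep e α.1 y) := by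
        refine setIntegral_congr_fun e.open_target.measurableSet fun y hy => ?_
        simp only [j, indicator_of_mem hy]
        exact (ContinuousLinearMap.integral_apply (integrable_of_compactSpace μ
          (hc.comp_continuous (f := fun x => (x, y)) (by fun_prop)
            fun x => ⟨mem_univ x, hy⟩)) _).symm

namespace IsSmoothCurrent

theorem zero : IsSmoothCurrent (0 : currents n m M) := fun _ _ =>
  ⟨fun _ => 0, contDiffOn_const, fun _ _ => (integral_zero _ _).symm⟩

theorem add {T S : currents n m M} (hT : IsSmoothCurrent T) (hS : IsSmoothCurrent S) :
    IsSmoothCurrent (T + S) := by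
  intro e he
  obtain ⟨c, hc, hTc⟩ := hT e he
  obtain ⟨d, hd, hSd⟩ := hS e he
  refine ⟨fun y => c y + d y, hc.add hd, fun α hα => ?_⟩
  have hadd := integral_add (integrableOn_coefficient_apply he hc.continuousOn hα)
    (integrableOn_coefficient_apply he hd.continuousOn hα)
  rw [← hTc α hα, ← hSd α hα] at hadd
  exact hadd.symm

theorem sum {ι : Type*} (s : Finset ι) {T : ι → currents n m M}
    (hT : ∀ i ∈ s, IsSmoothCurrent (T i)) : IsSmoothCurrent (∑ i ∈ s, T i) :=
  Finset.sum_induction T IsSmoothCurrent (fun _ _ => add) zero hT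

end IsSmoothCurrent

variable [T2Space M] [IsManifold (𝓡 n) ∞ M] {V B : Type*} [NormedAddCommGroup V]
  [NormedSpace ℝ V] [TopologicalSpace B] {I : ModelWithCorners ℝ V B} {P : Type*}
  [TopologicalSpace P] [ChartedSpace B P] [IsManifold I ∞ P] [CompactSpace P]
  [FirstCountableTopology P] [MeasurableSpace P] [OpensMeasurableSpace P] (μ : Measure P)
  [IsFiniteMeasure μ] {f : P → M ≃ₘ^∞⟮𝓡 n, 𝓡 n⟯ M}

theorem IsSmoothFamily.isSmoothCurrent_average (hf : IsSmoothFamily I f)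
    (he : e ∈ IsManifold.maximalAtlas (𝓡 n) ∞ M) {F : Euc n → Alt n m →L[ℝ] ℝ}
    (hF : ContDiff ℝ ∞ F) {K : Compacts (Euc n)} (hFK : Function.support F ⊆ K)
    (hKe : ↑K ⊆ e.target) {S : currents n m M}
    (hS : ∀ α : testForms n M m, S.1 α = ∫ z, F z (chartRep e α.1 z)) :
    IsSmoothCurrent (hf.average μ S) := by
  intro e' he'
  have hpushed := contMDiffOn_pushedDensity hf.contMDiff hf.contMDiff_symm
    (fun p => (f p).right_inv) he he' hF hFK hKe
  refine ⟨fun y => ∫ p, pushedDensity (fun p => f p) (fun p => (f p).symm) e e' F p y ∂μ,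
    contDiffOn_integral_of_compactSpace (.id P) μ e'.open_target hpushed, fun α hα => ?_⟩
  rw [← integral_setIntegral_coefficient_apply μ he' hpushed.continuousOn hα, hf.average_apply]
  refine integral_congr_ae (.of_forall fun p => (hS _).trans ?_)
  exact integral_chartRep_pullbackField hf.contMDiff hf.contMDiff_symm
    (fun p => (f p).right_inv) (fun p => (f p).left_inv) he he' (hFK.trans hKe)
    (fun x hx => notMem_formSupport fun h => hx (hα h)) p

end Coefficients

/-! ### Invariant regularization -/

section Regularization

variable {n : ℕ} {M : Type*} [TopologicalSpace M] [ChartedSpace (Euc n) M]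

theorem pullback_pullback [IsManifold (𝓡 n) ∞ M] {m : ℕ}
    (f g : M ≃ₘ^∞⟮𝓡 n, 𝓡 n⟯ M) (α : testForms n M m) :
    pullback f (pullback g α) = pullback (f.trans g) α := by
  refine Subtype.ext (funext fun x => ?_)
  have hcomp : mfderiv (𝓡 n) (𝓡 n) (g ∘ f) x =
      (mfderiv (𝓡 n) (𝓡 n) g (f x)).comp (mfderiv (𝓡 n) (𝓡 n) f x) :=
    mfderiv_comp x (g.contMDiff.mdifferentiable (by simp) _)
      (f.contMDiff.mdifferentiable (by simp) _)
  ext v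
  exact congrArg (α.1 (g (f x))) (funext fun i => (DFunLike.congr_fun hcomp (v i)).symm)

section Family

variable [IsManifold (𝓡 n) ∞ M] [T2Space M] [SecondCountableTopology M] {V B : Type*}
  [NormedAddCommGroup V] [NormedSpace ℝ V] [TopologicalSpace B] {I : ModelWithCorners ℝ V B}
  {P : Type*} [TopologicalSpace P] [ChartedSpace B P] [IsManifold I ∞ P] [CompactSpace P]
  [FirstCountableTopology P] [MeasurableSpace P] [OpensMeasurableSpace P] (μ : Measure P)
  [IsFiniteMeasure μ] {f : P → M ≃ₘ^∞⟮𝓡 n, 𝓡 n⟯ M}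

theorem IsSmoothFamily.exists_regularization (hf : IsSmoothFamily I f) (m : ℕ) :
    ∃ R : ℝ → (currents n m M →ₗ[ℝ] currents n m M), ∀ T,
      (∀ ε, IsSmoothCurrent (hf.average μ (R ε T))) ∧
        ∀ α, Tendsto (fun ε => (hf.average μ (R ε T)).1 α) (𝓝[>] 0)
          (𝓝 ((hf.average μ T).1 α)) := by
  obtain ⟨p, s, hps⟩ := DeRham.exists_regularization n M
  let R (ε : ℝ) : currents n m M →ₗ[ℝ] currents n m M := ∑ i ∈ s ε, (p i).regularize ε
  have hR (ε : ℝ) (T : currents n m M) (α : testForms n M m) :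
      (R ε T).1 α = ∑ i ∈ s ε, ((p i).regularize ε T).1 α := by
    simp only [R, LinearMap.sum_apply, Submodule.coe_sum]
  refine ⟨R, fun T => ⟨fun ε => ?_, fun α => ?_⟩⟩
  · rw [LinearMap.sum_apply, map_sum]
    exact .sum _ fun i _ => hf.isSmoothCurrent_average μ (p i).chart_mem
      ((p i).contDiff_density ε T) ((p i).support_density_subset ε T) (p i).core_subset_target
      ((p i).regularize_apply ε T)
  · refine tendsto_integral_of_compactSpace μ (fun ε => hf.continuous_current_pullback _ α)
      (hf.continuous_current_pullback T α) fun q => ?_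
    simp only [hR]
    exact hps m T (ℝ × P) _ Prod.fst (fun w => pullback (f w.2) α) (pullback (f q) α) tendsto_fst
      ((hf.formsTendstoZero_pullback_sub α q).comp_tendsto tendsto_snd)

end Family

section Group

variable {m k : ℕ} {G : Type*} [TopologicalSpace G] [ChartedSpace (Euc k) G] [Group G]
  [LieGroup (𝓡 k) ∞ G] [MulAction G M] [ContMDiffSMul (𝓡 k) (𝓡 n) ∞ G M]

variable (n M k G) in
theorem isSmoothFamily_smul :
    IsSmoothFamily (𝓡 k) fun g : G => (Diffeomorph.smul (𝓡 k) (𝓡 n) ∞ g : M ≃ₘ^∞⟮𝓡 n, 𝓡 n⟯ M) where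
  contMDiff := ContMDiffSMul.contMDiff_smul
  contMDiff_symm := ContMDiffSMul.contMDiff_smul.comp
    (((contMDiff_inv (𝓡 k) ∞).comp contMDiff_fst).prodMk contMDiff_snd)

variable [IsManifold (𝓡 n) ∞ M] [CompactSpace G] [FirstCountableTopology G]
  [MeasurableSpace G] [BorelSpace G] (μ : Measure G)

theorem isInvariantCurrent_average [IsFiniteMeasure μ] [μ.IsMulLeftInvariant]
    (T : currents n m M) :
    IsInvariantCurrent k G ((isSmoothFamily_smul n M k G).average μ T) := by
  have := topologicalGroup_of_lieGroup (𝓡 k) ∞ (G := G)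
  refine fun g => LinearMap.ext fun α => ?_
  have hmul (h : G) : (Diffeomorph.smul (𝓡 k) (𝓡 n) ∞ h : M ≃ₘ^∞⟮𝓡 n, 𝓡 n⟯ M).trans
      (Diffeomorph.smul (𝓡 k) (𝓡 n) ∞ g) = Diffeomorph.smul (𝓡 k) (𝓡 n) ∞ (g * h) :=
    Diffeomorph.ext fun x => (mul_smul g h x).symm
  simp only [pushforward, LinearMap.comp_apply, IsSmoothFamily.average_apply, pullback_pullback,
    hmul]
  exact integral_mul_left_eq_self
    (fun h => T.1 (pullback (Diffeomorph.smul (𝓡 k) (𝓡 n) ∞ h) α)) g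

theorem average_eq_self [IsProbabilityMeasure μ] {T : currents n m M}
    (hT : IsInvariantCurrent k G T) : (isSmoothFamily_smul n M k G).average μ T = T := by
  refine Subtype.ext (LinearMap.ext fun α => ?_)
  have hconst (g : G) : T.1 (pullback (Diffeomorph.smul (𝓡 k) (𝓡 n) ∞ g) α) = T.1 α :=
    LinearMap.congr_fun (hT g) α
  simp only [IsSmoothFamily.average_apply, hconst, integral_const, probReal_univ, one_smul]

end Group

end Regularization

end DeRham

open DeRham in
theorem theorem1p3_general (k n m : ℕ) (G : Type*) [TopologicalSpace G] [ChartedSpace (Euc k) G]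
    [Group G] [LieGroup (𝓡 k) ∞ G] [CompactSpace G] (M : Type*) [TopologicalSpace M]
    [ChartedSpace (Euc n) M] [IsManifold (𝓡 n) ∞ M] [T2Space M] [SecondCountableTopology M]
    [MulAction G M] [ContMDiffSMul (𝓡 k) (𝓡 n) ∞ G M] :
    ∃ (A : currents n m M →ₗ[ℝ] currents n m M) (Z : ℝ → (currents n m M →ₗ[ℝ] currents n m M)),
      (∀ T, IsInvariantCurrent k G T → A T = T) ∧
        ∀ T, (∀ ε, IsSmoothCurrent (Z ε T)) ∧ (∀ ε, IsInvariantCurrent k G (Z ε T)) ∧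
          ∀ α, Tendsto (fun ε => (Z ε T).1 α) (𝓝[>] 0) (𝓝 ((A T).1 α)) := by
  have := topologicalGroup_of_lieGroup (𝓡 k) ∞ (G := G)
  have := ChartedSpace.secondCountable_of_sigmaCompact (Euc k) G
  borelize G
  let μ : Measure G := Measure.haarMeasure ⊤
  have : IsProbabilityMeasure μ := ⟨Measure.haarMeasure_self⟩
  have hf := isSmoothFamily_smul n M k G
  obtain ⟨R, hR⟩ := hf.exists_regularization μ m
  exact ⟨hf.average μ, fun ε => hf.average μ ∘ₗ R ε, fun T hT => average_eq_self μ hT,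
    fun T => ⟨(hR T).1, fun ε => isInvariantCurrent_average μ (R ε T), (hR T).2⟩⟩

end

theorem theorem1p3 (k n m : ℕ)
    (G : Type*) [TopologicalSpace G] [ChartedSpace (EuclideanSpace ℝ (Fin k)) G] [Group G]
    [LieGroup (𝓡 k) ∞ G] [T2Space G] [CompactSpace G]
    (M : Type*) [TopologicalSpace M] [ChartedSpace (EuclideanSpace ℝ (Fin n)) M]
    [IsManifold (𝓡 n) ∞ M] [T2Space M] [SecondCountableTopology M]
    [MulAction G M] [ContMDiffSMul (𝓡 k) (𝓡 n) ∞ G M] :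
    ∃ Z : ℝ → (DeRham.currents n m M →ₗ[ℝ] DeRham.currents n m M),
      ∀ T : DeRham.currents n m M, DeRham.IsInvariantCurrent k G T →
        (∀ ε : ℝ, 0 < ε → DeRham.IsSmoothCurrent (Z ε T)) ∧
        (∀ ε : ℝ, 0 < ε → DeRham.IsInvariantCurrent k G (Z ε T)) ∧
        ∀ α : DeRham.testForms n M m,
          Tendsto (fun ε => (Z ε T).1 α) (𝓝[>] 0) (𝓝 (T.1 α)) := by
  obtain ⟨A, Z, hA, hZ⟩ := theorem1p3_general k n m G M
  exact ⟨Z, fun T hT => ⟨fun ε _ => (hZ T).1 ε, fun ε _ => (hZ T).2.1 ε,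
    fun α => by simpa only [hA T hT] using (hZ T).2.2 α⟩⟩
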